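/- A binary linear code $C$ of length $n$ is a subspace of $\mathrm{GF}(2)^n$; its minimum distance is the least Hamming distance between two distinct codewords (so the code must be nonzero), its dual is $C^\perp=\{u\mid u\cdot v=0\text{ for all }v\in C\}$, and its dual distance is the minimum distance of $C^\perp$. For $d,d^\perp\ge 1$ let $N(d,d^\perp)$ be the minimum $n$ for which there is a binary linear code of length $n$ with minimum distance at least $d$ and dual distance at least $d^\perp$. Then $N(3,3)=6$, $N(4,3)=7$, $N(4,4)=8$, $N(5,3)=11$, $N(5,4)=13$, $N(5,5)=16$, $N(6,3)=12$, $N(6,4)=14$, $N(6,5)=17$, $N(6,6)=18$, $N(7,3)=14$, $N(7,4)=15$, $N(8,3)=15$, $N(8,4)=16$. Moreover, the following codes attain these values. Here "an $[n,m,d]$ code with dual distance $d^\perp$" means a code of length $n$ and dimension $m$ whose minimum distance is exactly $d$ and whose dual distance is exactly $d^\perp$. - $(3,3)$: the $[7,4,3]$ Hamming code, shortened at any coordinate, is a $[6,3,3]$ code with dual distance $3$. - $(4,3)$: the dual of the Hamming code of length $7$ is a $[7,3,4]$ code with dual distance $3$ (the Hamming code itself being a $[7,4,3]$ code with dual distance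 $4$). - $(4,4)$: the extended Hamming code of length $8$ is an $[8,4,4]$ code with dual distance $4$. - $(5,3),(5,4),(5,5),(6,3),(6,5),(6,6)$: the codes generated by the rows of $G_{5,3},G_{5,4},G_{5,5},G_{6,3},G_{6,5},G_{6,6}$ below are respectively an $[11,4,5]$ code with dual distance $3$, a $[13,5,5]$ code with dual distance $4$, a $[16,8,5]$ code with dual distance $5$, a $[12,4,6]$ code with dual distance $3$, a $[17,8,6]$ code with dual distance $5$, and an $[18,9,6]$ code with dual distance $6$. - $(6,4)$: the dual of the code generated by the rows of $G_{6,4}$ below is a $[14,5,6]$ code with dual distance $4$. - $(7,3)$: the simplex code of length $15$, punctured at any coordinate, is a $[14,4,7]$ code with dual distance $3$. - $(7,4)$: the first order Reed-Muller code of length $16$, punctured at any coordinate, is a $[15,5,7]$ code with dual distance $4$. - $(8,3)$: the simplex code of length $15$ is a $[15,4,8]$ code with dual distance $3$. - $(8,4)$: the first order Reed-Muller code of length $16$ is a $[16,5,8]$ code with dual distance $4$. The matrices are: $$G_{5,3}=\left(\begin{array}{ccccccccccc} 1&0&0&0&0&0&0&1&1&1&1\\ 0&1&0&0&0&1&1&0&0&1&1\\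 0&0&1&0&1&0&1&0&1&0&1\\ 0&0&0&1&1&1&0&1&0&1&0 \end{array}\right)$$ $$G_{5,4}=\left(\begin{array}{ccccccccccccc} 1&0&0&0&0&0&0&0&0&1&1&1&1\\ 0&1&0&0&0&0&1&1&1&0&0&0&1\\ 0&0&1&0&0&1&0&1&1&0&1&1&0\\ 0&0&0&1&0&1&1&0&1&1&0&1&0\\ 0&0&0&0&1&1&1&1&0&1&1&0&1 \end{array}\right)$$ $$G_{5,5}=\left(\begin{array}{cccccccccccccccc} 1&0&0&0&0&0&0&0&0&0&0&0&1&1&1&1\\ 0&1&0&0&0&0&0&0&0&0&1&1&0&0&1&1\\ 0&0&1&0&0&0&0&0&0&1&0&1&0&1&0&1\\ 0&0&0&1&0&0&0&0&0&1&1&0&1&0&1&0\\ 0&0&0&0&1&0&0&0&1&0&0&1&0&1&1&0\\ 0&0&0&0&0&1&0&0&1&0&1&0&1&0&1&1\\ 0&0&0&0&0&0&1&0&1&1&0&1&1&0&1&1\\ 0&0&0&0&0&0&0&1&1&1&1&0&1&1&0&1 \end{array}\right)$$ $$G_{6,3}=\left(\begin{array}{cccccccccccc} 1&0&0&0&0&0&0&1&1&1&1&1\\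 0&1&0&0&0&1&1&0&0&1&1&1\\ 0&0&1&0&1&0&1&0&1&0&1&1\\ 0&0&0&1&1&1&0&1&0&1&0&1 \end{array}\right)$$ $$G_{6,4}=\left(\begin{array}{cccccccccccccc} 1&0&0&0&0&0&0&0&0&0&0&1&1&1\\ 0&1&0&0&0&0&0&0&0&0&1&0&1&1\\ 0&0&1&0&0&0&0&0&0&0&1&1&0&1\\ 0&0&0&1&0&0&0&0&0&0&1&1&1&0\\ 0&0&0&0&1&0&0&0&0&1&0&0&1&1\\ 0&0&0&0&0&1&0&0&0&1&0&1&0&1\\ 0&0&0&0&0&0&1&0&0&1&0&1&1&0\\ 0&0&0&0&0&0&0&1&0&1&1&0&0&1\\ 0&0&0&0&0&0&0&0&1&1&1&0&1&0 \end{array}\right)$$ $$G_{6,5}=\left(\begin{array}{ccccccccccccccccc} 1&0&0&0&0&0&0&0&0&0&0&0&1&1&1&1&1\\ 0&1&0&0&0&0&0&0&0&0&1&1&0&0&1&1&1\\ 0&0&1&0&0&0&0&0&0&1&0&1&0&1&0&1&1\\ 0&0&0&1&0&0&0&0&0&1&1&0&1&0&1&0&1\\ 0&0&0&0&1&0&0&0&1&0&0&1&0&1&1&0&1\\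 0&0&0&0&0&1&0&0&1&0&1&0&1&0&1&1&0\\ 0&0&0&0&0&0&1&0&1&1&0&1&1&0&1&1&1\\ 0&0&0&0&0&0&0&1&1&1&1&0&1&1&0&1&1 \end{array}\right)$$ $$G_{6,6}=\left(\begin{array}{cccccccccccccccccc} 1&0&0&0&0&0&0&0&0&0&0&0&0&1&1&1&1&1\\ 0&1&0&0&0&0&0&0&0&0&0&1&1&0&0&1&1&1\\ 0&0&1&0&0&0&0&0&0&0&1&0&1&0&1&0&1&1\\ 0&0&0&1&0&0&0&0&0&0&1&1&0&1&0&1&0&1\\ 0&0&0&0&1&0&0&0&0&1&0&0&1&0&1&1&0&1\\ 0&0&0&0&0&1&0&0&0&1&0&1&0&1&0&1&1&0\\ 0&0&0&0&0&0&1&0&0&1&1&0&1&1&0&1&1&1\\ 0&0&0&0&0&0&0&1&0&1&1&1&0&1&1&0&1&1\\ 0&0&0&0&0&0&0&0&1&1&1&1&1&0&1&1&1&0 \end{array}\right)$$ -/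

import Mathlib

/-! Binary linear codes of length `Fintype.card ι` are subspaces of `ι → ZMod 2`. -/

namespace BinaryCode

/-- The minimum Hamming distance between distinct codewords of `C`. For the zero code, which has no
two distinct codewords, the value is `0`, so that a bound `d ≤ minDist C` with `1 ≤ d` entails that
`C` has a nonzero codeword. -/
noncomputable def minDist {ι : Type*} [Fintype ι] (C : Submodule (ZMod 2) (ι → ZMod 2)) : ℕ :=
  sInf {w : ℕ | ∃ x ∈ C, ∃ y ∈ C, x ≠ y ∧ hammingDist x y = w}

/-- The dual code, with respect to the standard inner product. -/
def dual {ι : Type*} [Fintype ι] (C : Submodule (ZMod 2) (ι → ZMod 2)) :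
    Submodule (ZMod 2) (ι → ZMod 2) where
  carrier := {u | ∀ v ∈ C, u ⬝ᵥ v = 0}
  add_mem' := fun {a b} ha hb v hv => by rw [add_dotProduct, ha v hv, hb v hv, add_zero]
  zero_mem' := fun v _ => zero_dotProduct v
  smul_mem' := fun c a ha v hv => by rw [smul_dotProduct, ha v hv, smul_zero]

/-- `N d e` is the minimum length of a binary linear code with minimum distance at least `d` and
dual distance at least `e`. (If there were no such code the value would be `0`; for `d, e ≥ 1`,
length `0` is itself not possible, so a positive value is always an attained minimum.) -/
noncomputable def N (d e : ℕ) : ℕ :=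
  sInf {n : ℕ | ∃ C : Submodule (ZMod 2) (Fin n → ZMod 2), d ≤ minDist C ∧ e ≤ minDist (dual C)}

/-- `C` has length `n`, dimension `m`, minimum distance exactly `d` and dual distance
exactly `e`. -/
structure HasParameters {ι : Type*} [Fintype ι] (C : Submodule (ZMod 2) (ι → ZMod 2))
    (n m d e : ℕ) : Prop where
  length_eq : Fintype.card ι = n
  finrank_eq : Module.finrank (ZMod 2) C = m
  minDist_eq : minDist C = d
  dualDist_eq : minDist (dual C) = e

/-- The code spanned by the rows of `G`. -/
def rowCode {κ ι : Type*} (G : Matrix κ ι (ZMod 2)) : Submodule (ZMod 2) (ι → ZMod 2) :=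
  Submodule.span (ZMod 2) (Set.range G.row)

/-- The `r × (2 ^ r - 1)` matrix whose columns are all the nonzero binary vectors of length `r`. -/
def nonzeroColumns (r : ℕ) : Matrix (Fin r) {v : Fin r → ZMod 2 // v ≠ 0} (ZMod 2) :=
  Matrix.of fun i v => v.1 i

/-- The `[2 ^ r - 1, r]` simplex code. -/
def simplexCode (r : ℕ) : Submodule (ZMod 2) ({v : Fin r → ZMod 2 // v ≠ 0} → ZMod 2) :=
  rowCode (nonzeroColumns r)

/-- The `[2 ^ r - 1, 2 ^ r - 1 - r]` Hamming code, with parity check matrix `nonzeroColumns r`. -/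
def hammingCode (r : ℕ) : Submodule (ZMod 2) ({v : Fin r → ZMod 2 // v ≠ 0} → ZMod 2) :=
  LinearMap.ker (nonzeroColumns r).mulVecLin

/-- The first order Reed-Muller code of length `2 ^ m`: the value tables of the affine functions
in `m` binary variables, spanned by the constant `1` and the coordinate functions. -/
def reedMullerOne (m : ℕ) : Submodule (ZMod 2) ((Fin m → ZMod 2) → ZMod 2) :=
  Submodule.span (ZMod 2) (insert 1 (Set.range fun (i : Fin m) (x : Fin m → ZMod 2) => x i))

/-- Deletion of the coordinate `p`. -/
def deleteCoord {ι : Type*} (p : ι) : (ι → ZMod 2) →ₗ[ZMod 2] ({i : ι // i ≠ p} → ZMod 2) :=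
  LinearMap.funLeft (ZMod 2) (ZMod 2) Subtype.val

/-- The code punctured at `p`: delete the coordinate `p` from every codeword. -/
def puncture {ι : Type*} (C : Submodule (ZMod 2) (ι → ZMod 2)) (p : ι) :
    Submodule (ZMod 2) ({i : ι // i ≠ p} → ZMod 2) :=
  C.map (deleteCoord p)

/-- The code shortened at `p`: delete the coordinate `p` from the codewords that vanish there. -/
def shorten {ι : Type*} (C : Submodule (ZMod 2) (ι → ZMod 2)) (p : ι) :
    Submodule (ZMod 2) ({i : ι // i ≠ p} → ZMod 2) :=
  (C ⊓ LinearMap.ker (LinearMap.proj p : (ι → ZMod 2) →ₗ[ZMod 2] ZMod 2)).map (deleteCoord p)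

/-- The extended code: append to every codeword its parity (as the coordinate `none`). -/
def extend {ι : Type*} [Fintype ι] (C : Submodule (ZMod 2) (ι → ZMod 2)) :
    Submodule (ZMod 2) (Option ι → ZMod 2) where
  carrier := {x | (fun i => x (some i)) ∈ C ∧ x none = ∑ i, x (some i)}
  add_mem' := fun {a b} ha hb => ⟨C.add_mem ha.1 hb.1, by
    simp only [Pi.add_apply, ha.2, hb.2, Finset.sum_add_distrib]⟩
  zero_mem' := ⟨C.zero_mem, by simp⟩
  smul_mem' := fun c a ha => ⟨C.smul_mem c ha.1, by
    simp only [Pi.smul_apply, ha.2, Finset.smul_sum]⟩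

def G53 : Matrix (Fin 4) (Fin 11) (ZMod 2) :=
  !![1, 0, 0, 0, 0, 0, 0, 1, 1, 1, 1;
     0, 1, 0, 0, 0, 1, 1, 0, 0, 1, 1;
     0, 0, 1, 0, 1, 0, 1, 0, 1, 0, 1;
     0, 0, 0, 1, 1, 1, 0, 1, 0, 1, 0]

def G54 : Matrix (Fin 5) (Fin 13) (ZMod 2) :=
  !![1, 0, 0, 0, 0, 0, 0, 0, 0, 1, 1, 1, 1;
     0, 1, 0, 0, 0, 0, 1, 1, 1, 0, 0, 0, 1;
     0, 0, 1, 0, 0, 1, 0, 1, 1, 0, 1, 1, 0;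
     0, 0, 0, 1, 0, 1, 1, 0, 1, 1, 0, 1, 0;
     0, 0, 0, 0, 1, 1, 1, 1, 0, 1, 1, 0, 1]

def G55 : Matrix (Fin 8) (Fin 16) (ZMod 2) :=
  !![1, 0, 0, 0, 0, 0, 0, 0, 0, 0, 0, 0, 1, 1, 1, 1;
     0, 1, 0, 0, 0, 0, 0, 0, 0, 0, 1, 1, 0, 0, 1, 1;
     0, 0, 1, 0, 0, 0, 0, 0, 0, 1, 0, 1, 0, 1, 0, 1;
     0, 0, 0, 1, 0, 0, 0, 0, 0, 1, 1, 0, 1, 0, 1, 0;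
     0, 0, 0, 0, 1, 0, 0, 0, 1, 0, 0, 1, 0, 1, 1, 0;
     0, 0, 0, 0, 0, 1, 0, 0, 1, 0, 1, 0, 1, 0, 1, 1;
     0, 0, 0, 0, 0, 0, 1, 0, 1, 1, 0, 1, 1, 0, 1, 1;
     0, 0, 0, 0, 0, 0, 0, 1, 1, 1, 1, 0, 1, 1, 0, 1]

def G63 : Matrix (Fin 4) (Fin 12) (ZMod 2) :=
  !![1, 0, 0, 0, 0, 0, 0, 1, 1, 1, 1, 1;
     0, 1, 0, 0, 0, 1, 1, 0, 0, 1, 1, 1;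
     0, 0, 1, 0, 1, 0, 1, 0, 1, 0, 1, 1;
     0, 0, 0, 1, 1, 1, 0, 1, 0, 1, 0, 1]

def G64 : Matrix (Fin 9) (Fin 14) (ZMod 2) :=
  !![1, 0, 0, 0, 0, 0, 0, 0, 0, 0, 0, 1, 1, 1;
     0, 1, 0, 0, 0, 0, 0, 0, 0, 0, 1, 0, 1, 1;
     0, 0, 1, 0, 0, 0, 0, 0, 0, 0, 1, 1, 0, 1;
     0, 0, 0, 1, 0, 0, 0, 0, 0, 0, 1, 1, 1, 0;
     0, 0, 0, 0, 1, 0, 0, 0, 0, 1, 0, 0, 1, 1;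
     0, 0, 0, 0, 0, 1, 0, 0, 0, 1, 0, 1, 0, 1;
     0, 0, 0, 0, 0, 0, 1, 0, 0, 1, 0, 1, 1, 0;
     0, 0, 0, 0, 0, 0, 0, 1, 0, 1, 1, 0, 0, 1;
     0, 0, 0, 0, 0, 0, 0, 0, 1, 1, 1, 0, 1, 0]

def G65 : Matrix (Fin 8) (Fin 17) (ZMod 2) :=
  !![1, 0, 0, 0, 0, 0, 0, 0, 0, 0, 0, 0, 1, 1, 1, 1, 1;
     0, 1, 0, 0, 0, 0, 0, 0, 0, 0, 1, 1, 0, 0, 1, 1, 1;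
     0, 0, 1, 0, 0, 0, 0, 0, 0, 1, 0, 1, 0, 1, 0, 1, 1;
     0, 0, 0, 1, 0, 0, 0, 0, 0, 1, 1, 0, 1, 0, 1, 0, 1;
     0, 0, 0, 0, 1, 0, 0, 0, 1, 0, 0, 1, 0, 1, 1, 0, 1;
     0, 0, 0, 0, 0, 1, 0, 0, 1, 0, 1, 0, 1, 0, 1, 1, 0;
     0, 0, 0, 0, 0, 0, 1, 0, 1, 1, 0, 1, 1, 0, 1, 1, 1;
     0, 0, 0, 0, 0, 0, 0, 1, 1, 1, 1, 0, 1, 1, 0, 1, 1]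

def G66 : Matrix (Fin 9) (Fin 18) (ZMod 2) :=
  !![1, 0, 0, 0, 0, 0, 0, 0, 0, 0, 0, 0, 0, 1, 1, 1, 1, 1;
     0, 1, 0, 0, 0, 0, 0, 0, 0, 0, 0, 1, 1, 0, 0, 1, 1, 1;
     0, 0, 1, 0, 0, 0, 0, 0, 0, 0, 1, 0, 1, 0, 1, 0, 1, 1;
     0, 0, 0, 1, 0, 0, 0, 0, 0, 0, 1, 1, 0, 1, 0, 1, 0, 1;
     0, 0, 0, 0, 1, 0, 0, 0, 0, 1, 0, 0, 1, 0, 1, 1, 0, 1;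
     0, 0, 0, 0, 0, 1, 0, 0, 0, 1, 0, 1, 0, 1, 0, 1, 1, 0;
     0, 0, 0, 0, 0, 0, 1, 0, 0, 1, 1, 0, 1, 1, 0, 1, 1, 1;
     0, 0, 0, 0, 0, 0, 0, 1, 0, 1, 1, 1, 0, 1, 1, 0, 1, 1;
     0, 0, 0, 0, 0, 0, 0, 0, 1, 1, 1, 1, 1, 0, 1, 1, 1, 0]

end BinaryCode

open BinaryCode

/-! The lower bounds rest on `dim C + dim C⊥ = n`. If every code of length `n` with minimum distance
at least `d` has dimension at most `a`, every one with minimum distance at least `e` has dimension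
at most `b`, and `a + b < n`, then length `n` is impossible (`noCode_of_finrank_le`). The dimension
bounds come from Delsarte's linear programming method: the MacWilliams identities turn a polynomial
`∑ f_j K_j` with `f_j ≥ 0`, nonpositive on the admissible weights, into an upper bound for `|C|`,
and explicit integer multipliers are checked by evaluation.

Linear programming fails once: it leaves open a code of length 12, dimension 5 and distance 5. Such
a code would have dual distance at least 4, by shortening on the support of a dual word, and the
MacWilliams identities then have no solution in natural numbers (`finrank_le_four_of_twelve`).
Shortening extends this to `k ≤ n - 8` for distance 5 and every `n ≥ 12`; applied to `C` and `C⊥` it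
gives `n ≥ 16` for `(5,5)`.

This treats `(3,3)`, `(5,3)`, `(5,4)`, `(5,5)`, `(7,3)` and `(7,4)`. The remaining pairs follow
because puncturing costs one coordinate and at most one unit of distance while shortening the dual,
so that raising `d ≥ 2` by one raises the bound on the length by one (`NoCode.succ`), and because
the problem is symmetric under duality.

For the upper bounds, a generator matrix and a check matrix reduce both distances to finite
enumerations of row combinations; in the Hamming, simplex and Reed-Muller families the dual distance
comes from the geometry of the columns instead. -/

namespace BinaryCode

variable {ι κ : Type*} [Fintype ι] [Fintype κ]

/-! ### Duality, and minimum distance as minimum weight -/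

theorem mem_dual {C : Submodule (ZMod 2) (ι → ZMod 2)} {u : ι → ZMod 2} :
    u ∈ dual C ↔ ∀ v ∈ C, u ⬝ᵥ v = 0 := Iff.rfl

theorem finrank_add_finrank_dual (C : Submodule (ZMod 2) (ι → ZMod 2)) :
    Module.finrank (ZMod 2) C + Module.finrank (ZMod 2) (dual C) = Fintype.card ι := by
  classical
  have h : dual C = C.dualAnnihilator.comap (dotProductEquiv (ZMod 2) ι).toLinearMap := by
    ext u
    simp [mem_dual, Submodule.mem_dualAnnihilator]
  have h2 : Module.finrank (ZMod 2) (dual C) = Module.finrank (ZMod 2) C.dualAnnihilator := by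
    rw [h]
    exact ((dotProductEquiv (ZMod 2) ι).submoduleMap _ |>.finrank_eq).trans (congrArg
      (fun S : Submodule (ZMod 2) (Module.Dual (ZMod 2) (ι → ZMod 2)) => Module.finrank (ZMod 2) S)
      (Submodule.map_comap_eq_of_surjective (dotProductEquiv (ZMod 2) ι).surjective _))
  rw [h2, Subspace.finrank_add_finrank_dualAnnihilator_eq, Module.finrank_pi]

theorem le_dual_dual (C : Submodule (ZMod 2) (ι → ZMod 2)) : C ≤ dual (dual C) :=
  fun x hx u hu => by rw [dotProduct_comm]; exact hu x hx

theorem dual_dual (C : Submodule (ZMod 2) (ι → ZMod 2)) : dual (dual C) = C := by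
  refine (Submodule.eq_of_le_of_finrank_eq (le_dual_dual C) ?_).symm
  have h1 := finrank_add_finrank_dual C
  have h2 := finrank_add_finrank_dual (dual C)
  omega

theorem natCard_eq_two_pow (C : Submodule (ZMod 2) (ι → ZMod 2)) :
    Nat.card C = 2 ^ Module.finrank (ZMod 2) C := by
  rw [Module.natCard_eq_pow_finrank (K := ZMod 2), Nat.card_zmod]

/-- Every nonzero word of `C` has weight at least `d`. -/
def WeightGE (C : Submodule (ZMod 2) (ι → ZMod 2)) (d : ℕ) : Prop :=
  ∀ x ∈ C, x ≠ 0 → d ≤ hammingNorm x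

theorem WeightGE.mono {C : Submodule (ZMod 2) (ι → ZMod 2)} {d d' : ℕ} (h : WeightGE C d)
    (hd : d' ≤ d) : WeightGE C d' := fun x hx hx0 => hd.trans (h x hx hx0)

/-- The condition `C ≠ ⊥` is forced by the convention that the zero code has minimum distance 0,
which is also why `1 ≤ d` is needed. -/
theorem le_minDist_iff {C : Submodule (ZMod 2) (ι → ZMod 2)} {d : ℕ} (hd : 1 ≤ d) :
    d ≤ minDist C ↔ C ≠ ⊥ ∧ WeightGE C d := by
  unfold minDist
  constructor
  · intro h
    have hne : {w : ℕ | ∃ x ∈ C, ∃ y ∈ C, x ≠ y ∧ hammingDist x y = w}.Nonempty := by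
      by_contra hn
      rw [Set.not_nonempty_iff_eq_empty.1 hn, Nat.sInf_empty] at h
      omega
    refine ⟨?_, fun x hx hx0 => h.trans (Nat.sInf_le ⟨x, hx, 0, C.zero_mem, hx0, by simp⟩)⟩
    rintro rfl
    obtain ⟨w, x, hx, y, hy, hxy, -⟩ := hne
    exact hxy ((Submodule.mem_bot _).1 hx |>.trans ((Submodule.mem_bot _).1 hy).symm)
  · rintro ⟨h0, h⟩
    obtain ⟨x, hx, hx0⟩ := Submodule.exists_mem_ne_zero_of_ne_bot h0
    refine le_csInf ⟨_, x, hx, 0, C.zero_mem, hx0, rfl⟩ ?_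
    rintro w ⟨x, hx, y, hy, hxy, rfl⟩
    rw [hammingDist_eq_hammingNorm]
    exact h _ (C.add_mem (C.neg_mem hx) hy) fun h => hxy (neg_add_eq_zero.1 h)

theorem minDist_eq_of_weightGE {C : Submodule (ZMod 2) (ι → ZMod 2)} {d : ℕ} (hd : 1 ≤ d)
    (h : WeightGE C d) (hx : ∃ x ∈ C, hammingNorm x = d) : minDist C = d := by
  obtain ⟨x, hx, rfl⟩ := hx
  have hx0 : x ≠ 0 := hammingNorm_pos_iff.1 hd
  refine le_antisymm (Nat.sInf_le ⟨x, hx, 0, C.zero_mem, hx0, by simp⟩)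
    ((le_minDist_iff hd).2 ⟨fun hC => hx0 ?_, h⟩)
  rwa [hC, Submodule.mem_bot] at hx

/-! ### The MacWilliams identities and the linear programming bound -/

/-- The nontrivial character of `ZMod 2`. -/
def chi (a : ZMod 2) : ℤ := if a = 0 then 1 else -1

theorem chi_add : ∀ a b : ZMod 2, chi (a + b) = chi a * chi b := by decide

theorem chi_sum {α : Type*} (s : Finset α) (g : α → ZMod 2) :
    chi (∑ i ∈ s, g i) = ∏ i ∈ s, chi (g i) := by
  classical
  induction s using Finset.induction_on with
  | empty => rfl
  | insert a s ha ih => rw [Finset.sum_insert ha, Finset.prod_insert ha, chi_add, ih]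

/-- The binary Krawtchouk number `K_j(w)` for length `n`. -/
def kraw (n j w : ℕ) : ℤ :=
  ∑ i ∈ Finset.range (j + 1), (-1) ^ i * (w.choose i : ℤ) * ((n - w).choose (j - i) : ℤ)

/-- Orthogonality of characters: `x ↦ chi (u ⬝ᵥ x)` is a character of `C`, trivial exactly when `u`
lies in the dual. -/
theorem sum_chi_mem (C : Submodule (ZMod 2) (ι → ZMod 2)) [Fintype C] (u : ι → ZMod 2)
    [Decidable (u ∈ dual C)] :
    ∑ x : C, chi (u ⬝ᵥ x.1) = if u ∈ dual C then (Fintype.card C : ℤ) else 0 := by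
  split_ifs with hu
  · rw [Finset.sum_congr rfl (fun x _ => by rw [hu x.1 x.2]), Finset.sum_const]
    simp [chi]
  · obtain ⟨v, hv, hvu⟩ : ∃ v ∈ C, u ⬝ᵥ v ≠ 0 := by
      by_contra! h
      exact hu h
    have h1 : chi (u ⬝ᵥ v) = -1 := if_neg hvu
    -- Translation by `v` permutes `C` and changes the sign of every term, so the sum equals its own
    -- negative.
    have h2 : ∑ x : C, chi (u ⬝ᵥ x.1) = ∑ x : C, chi (u ⬝ᵥ (x + ⟨v, hv⟩ : C).1) :=
      (Equiv.sum_comp (Equiv.addRight (⟨v, hv⟩ : C)) fun x : C => chi (u ⬝ᵥ x.1)).symm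
    simp only [Submodule.coe_add, dotProduct_add, chi_add, h1, mul_neg, mul_one,
      Finset.sum_neg_distrib] at h2
    omega

/-- Binary words correspond to their supports. -/
noncomputable def supportEquiv (ι : Type*) [Fintype ι] : Finset ι ≃ (ι → ZMod 2) := by
  classical
  exact
  { toFun := fun s i => if i ∈ s then 1 else 0
    invFun := fun u => {i | u i ≠ 0}
    left_inv := fun s => by ext; simp
    right_inv := fun u => by
      ext i
      have : ∀ a : ZMod 2, (if a ≠ 0 then 1 else 0) = a := by decide
      simpa using this (u i) }

theorem supportEquiv_apply [DecidableEq ι] (s : Finset ι) (i : ι) :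
    supportEquiv ι s i = if i ∈ s then 1 else 0 := by
  simp [supportEquiv]

theorem hammingNorm_supportEquiv (s : Finset ι) : hammingNorm (supportEquiv ι s) = s.card := by
  classical
  simp [hammingNorm, supportEquiv_apply]

theorem supportEquiv_dotProduct (s : Finset ι) (x : ι → ZMod 2) :
    supportEquiv ι s ⬝ᵥ x = ∑ i ∈ s, x i := by
  classical
  simp [dotProduct, supportEquiv_apply]

open Polynomial in
-- Both sides are the coefficient of `X ^ j` in `∏ (1 + chi (x i) X) = (1 - X) ^ w (1 + X) ^ (n -
-- w)`, where `w` is the weight of `x`: expand the product over subsets on one side and by the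
-- binomial theorem on the other.
theorem sum_powersetCard_chi (x : ι → ZMod 2) (j : ℕ) :
    ∑ s ∈ Finset.powersetCard j Finset.univ, chi (∑ i ∈ s, x i) =
      kraw (Fintype.card ι) j (hammingNorm x) := by
  classical
  have hprod : ∏ i, (1 + C (chi (x i)) * X : ℤ[X]) =
      ((1 + X) ^ hammingNorm x).comp (-X) * (1 + X) ^ (Fintype.card ι - hammingNorm x) := by
    rw [← Finset.prod_filter_mul_prod_filter_not Finset.univ fun i => x i ≠ 0]
    congr 1
    · rw [Finset.prod_congr rfl (g := fun _ => (1 + X : ℤ[X]).comp (-X)), Finset.prod_const]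
      · simp [hammingNorm]
      · intro i hi
        simp [chi, (Finset.mem_filter.1 hi).2]
    · rw [Finset.prod_congr rfl (g := fun _ => (1 + X : ℤ[X])), Finset.prod_const]
      · congr 1
        have := Finset.card_filter_add_card_filter_not
          (s := (Finset.univ : Finset ι)) (fun i => x i ≠ 0)
        rw [Finset.card_univ] at this
        unfold hammingNorm
        omega
      · intro i hi
        have h : x i = 0 := by simpa using (Finset.mem_filter.1 hi).2
        simp [chi, h]
  have hcoeff : (∏ i, (1 + C (chi (x i)) * X : ℤ[X])).coeff j =
      ∑ s ∈ Finset.powersetCard j Finset.univ, chi (∑ i ∈ s, x i) := by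
    rw [Finset.prod_one_add, finsetSum_coeff, Finset.powersetCard_eq_filter, Finset.sum_filter]
    refine Finset.sum_congr rfl fun s _ => ?_
    rw [Finset.prod_mul_distrib, Finset.prod_const, ← map_prod, coeff_C_mul_X_pow, ← chi_sum]
    simp only [eq_comm]
  rw [← hcoeff, hprod, coeff_mul, Finset.Nat.sum_antidiagonal_eq_sum_range_succ
    (fun a b => (((1 + X : ℤ[X]) ^ hammingNorm x).comp (-X)).coeff a *
      ((1 + X : ℤ[X]) ^ (Fintype.card ι - hammingNorm x)).coeff b), kraw]
  refine Finset.sum_congr rfl fun i _ => ?_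
  rw [coeff_one_add_X_pow, show (-X : ℤ[X]) = C (-1) * X by simp, comp_C_mul_X_coeff,
    coeff_one_add_X_pow]
  ring

/-- The number of words of weight `w` in `C`. -/
noncomputable def weightCount (C : Submodule (ZMod 2) (ι → ZMod 2)) (w : ℕ) : ℕ :=
  Nat.card {x : ι → ZMod 2 // x ∈ C ∧ hammingNorm x = w}

/-- Write the Krawtchouk number as a character sum over the words of weight `j`, exchange the two
sums, and let orthogonality retain only those words that lie in the dual. -/
theorem sum_kraw_mem (C : Submodule (ZMod 2) (ι → ZMod 2)) [Fintype C] (j : ℕ) :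
    ∑ x : C, kraw (Fintype.card ι) j (hammingNorm x.1) =
      Nat.card C * weightCount (dual C) j := by
  classical
  simp_rw [← sum_powersetCard_chi]
  rw [Finset.sum_comm]
  simp_rw [← supportEquiv_dotProduct, sum_chi_mem]
  rw [Finset.sum_ite, Finset.sum_const_zero, add_zero, Finset.sum_const, nsmul_eq_mul, mul_comm,
    Nat.card_eq_fintype_card, weightCount]
  congr 2
  rw [Nat.card_eq_fintype_card, Fintype.card_subtype]
  refine Finset.card_bij (fun s _ => supportEquiv ι s) ?_ ?_ ?_
  · intro s hs
    simpa [hammingNorm_supportEquiv, and_comm] using hs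
  · intro s _ t _ h
    exact (supportEquiv ι).injective h
  · intro u hu
    obtain ⟨s, rfl⟩ := (supportEquiv ι).surjective u
    exact ⟨s, by simpa [hammingNorm_supportEquiv, and_comm] using hu, rfl⟩

theorem sum_mem_eq_sum_weightCount (C : Submodule (ZMod 2) (ι → ZMod 2)) [Fintype C] (g : ℕ → ℤ) :
    ∑ x : C, g (hammingNorm x.1) =
      ∑ w ∈ Finset.range (Fintype.card ι + 1), weightCount C w * g w := by
  classical
  rw [← Finset.sum_fiberwise_of_maps_to (t := Finset.range (Fintype.card ι + 1))
    (g := fun x : C => hammingNorm x.1)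
    (fun x _ => Finset.mem_range.2 (Nat.lt_succ_of_le hammingNorm_le_card_fintype))]
  refine Finset.sum_congr rfl fun w _ => ?_
  rw [Finset.sum_congr rfl (g := fun _ => g w)
    (fun x hx => by rw [(Finset.mem_filter.1 hx).2]), Finset.sum_const, nsmul_eq_mul]
  congr 2
  rw [← Fintype.card_subtype, weightCount, ← Nat.card_eq_fintype_card]
  exact Nat.card_congr
    { toFun := fun x => ⟨x.1.1, x.1.2, x.2⟩
      invFun := fun x => ⟨⟨x.1, x.2.1⟩, x.2.2⟩
      left_inv := fun _ => rfl
      right_inv := fun _ => rfl }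

theorem macWilliams (C : Submodule (ZMod 2) (ι → ZMod 2)) (j : ℕ) :
    ∑ w ∈ Finset.range (Fintype.card ι + 1), weightCount C w * kraw (Fintype.card ι) j w =
      Nat.card C * (weightCount (dual C) j : ℤ) := by
  classical
  rw [← sum_kraw_mem, ← sum_mem_eq_sum_weightCount]

theorem weightCount_zero (C : Submodule (ZMod 2) (ι → ZMod 2)) : weightCount C 0 = 1 := by
  rw [weightCount, Nat.card_eq_one_iff_unique]
  refine ⟨⟨fun a b => Subtype.ext ?_⟩, ⟨⟨0, C.zero_mem, hammingNorm_zero⟩⟩⟩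
  rw [hammingNorm_eq_zero.1 a.2.2, hammingNorm_eq_zero.1 b.2.2]

theorem weightCount_eq_zero {C : Submodule (ZMod 2) (ι → ZMod 2)} {w : ℕ}
    (h : ∀ x ∈ C, hammingNorm x ≠ w) : weightCount C w = 0 := by
  rw [weightCount, Nat.card_eq_zero]
  exact Or.inl ⟨fun x => h x.1 x.2.1 x.2.2⟩

theorem WeightGE.weightCount_eq_zero {C : Submodule (ZMod 2) (ι → ZMod 2)} {d w : ℕ}
    (h : WeightGE C d) (h0 : w ≠ 0) (hw : w < d) : weightCount C w = 0 := by
  refine BinaryCode.weightCount_eq_zero fun x hx hxw => ?_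
  have := h x hx (hammingNorm_ne_zero_iff.1 (hxw ▸ h0))
  omega

/-- A certificate for the linear programming bound: the polynomial `∑ j, f j * K_j` has
nonnegative coefficients, is nonpositive at `d, …, n`, and its value at `0` is less than
`M * f 0`. -/
def lpCertificate (n d M : ℕ) (f : List ℕ) : Bool :=
  let g := fun w => ∑ j ∈ Finset.range (n + 1), (f.getD j 0 : ℤ) * kraw n j w
  decide (0 < f.getD 0 0) &&
    (List.range (n + 1)).all (fun w => decide (w < d) || decide (g w ≤ 0)) &&
    decide (g 0 < M * f.getD 0 0)

/-- The sum `∑ A_w g(w)` is estimated twice. Only `w = 0` can contribute positively, so it is at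
most `g 0`; by MacWilliams it is `|C| ∑ f_j B_j`, at least `|C| f_0` since `B_0 = 1` and `f_j, B_j ≥
0`. -/
theorem natCard_lt_of_lpCertificate {C : Submodule (ZMod 2) (ι → ZMod 2)} {n d M : ℕ}
    (f : List ℕ) (hf : lpCertificate n d M f = true) (hn : Fintype.card ι = n)
    (hC : WeightGE C d) : Nat.card C < M := by
  subst hn
  simp only [lpCertificate, Bool.and_eq_true, decide_eq_true_eq, List.all_eq_true, List.mem_range,
    Bool.or_eq_true] at hf
  obtain ⟨⟨h0, hneg⟩, hlt⟩ := hf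
  set n := Fintype.card ι
  set g : ℕ → ℤ := fun w => ∑ j ∈ Finset.range (n + 1), (f.getD j 0 : ℤ) * kraw n j w with hg
  have h1 : ∑ w ∈ Finset.range (n + 1), weightCount C w * g w ≤ g 0 := by
    rw [← Finset.sum_erase_add _ _ (Finset.mem_range.2 (Nat.succ_pos n)), weightCount_zero]
    simp only [Nat.cast_one, one_mul, add_le_iff_nonpos_left]
    refine Finset.sum_nonpos fun w hw => ?_
    obtain ⟨hw0, hwn⟩ := Finset.mem_erase.1 hw
    rcases hneg w (Finset.mem_range.1 hwn) with h | h
    · rw [hC.weightCount_eq_zero hw0 h, Nat.cast_zero, zero_mul]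
    · exact mul_nonpos_of_nonneg_of_nonpos (Nat.cast_nonneg _) h
  have h2 : (Nat.card C : ℤ) * f.getD 0 0 ≤ ∑ w ∈ Finset.range (n + 1), weightCount C w * g w := by
    have : ∑ w ∈ Finset.range (n + 1), weightCount C w * g w =
        ∑ j ∈ Finset.range (n + 1), (f.getD j 0 : ℤ) *
          (Nat.card C * (weightCount (dual C) j : ℤ)) := by
      simp_rw [hg, Finset.mul_sum, ← macWilliams, Finset.mul_sum]
      rw [Finset.sum_comm]
      exact Finset.sum_congr rfl fun _ _ => Finset.sum_congr rfl fun _ _ => by ring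
    rw [this]
    refine le_trans (le_of_eq ?_) (Finset.single_le_sum (f := fun j => (f.getD j 0 : ℤ) *
          (Nat.card C * (weightCount (dual C) j : ℤ))) (fun j _ => by positivity)
          (Finset.mem_range.2 (Nat.succ_pos n)))
    simp [weightCount_zero, mul_comm]
  have h3 : (Nat.card C : ℤ) * f.getD 0 0 < M * f.getD 0 0 := (h2.trans h1).trans_lt hlt
  exact_mod_cast lt_of_mul_lt_mul_right h3 (by positivity)

theorem finrank_le_of_lpCertificate {C : Submodule (ZMod 2) (ι → ZMod 2)} {n d k : ℕ}
    (f : List ℕ) (hf : lpCertificate n d (2 ^ (k + 1)) f = true) (hn : Fintype.card ι = n)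
    (hC : WeightGE C d) : Module.finrank (ZMod 2) C ≤ k := by
  have h := natCard_lt_of_lpCertificate f hf hn hC
  rw [natCard_eq_two_pow] at h
  exact Nat.lt_succ_iff.1 ((Nat.pow_lt_pow_iff_right one_lt_two).1 h)

/-! ### Shortening on a set of coordinates, and the exceptional length 12 -/

/-- The code shortened at all coordinates of `S`. -/
def shortenOn (C : Submodule (ZMod 2) (ι → ZMod 2)) (S : Finset ι) :
    Submodule (ZMod 2) ({i : ι // i ∉ S} → ZMod 2) :=
  (C ⊓ LinearMap.ker (LinearMap.funLeft (ZMod 2) (ZMod 2) (Subtype.val : S → ι))).map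
    (LinearMap.funLeft (ZMod 2) (ZMod 2) Subtype.val)

theorem hammingNorm_comp_val {p : ι → Prop} [Fintype {i // p i}] (x : ι → ZMod 2)
    (hx : ∀ i, ¬ p i → x i = 0) :
    hammingNorm (fun i : {i // p i} => x i.1) = hammingNorm x := by
  classical
  unfold hammingNorm
  refine Finset.card_bij (fun i _ => i.1) ?_ ?_ ?_
  · intro i hi
    simpa using hi
  · intro i _ j _ h
    exact Subtype.ext h
  · intro i hi
    refine ⟨⟨i, ?_⟩, by simpa using hi, rfl⟩
    by_contra hp
    exact (Finset.mem_filter.1 hi).2 (hx i hp)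

theorem WeightGE.shortenOn [DecidableEq ι] {C : Submodule (ZMod 2) (ι → ZMod 2)} {d : ℕ}
    (h : WeightGE C d) (S : Finset ι) : WeightGE (shortenOn C S) d := by
  rintro _ ⟨x, ⟨hxC, hxS⟩, rfl⟩ h0
  have hx : ∀ i, ¬ i ∉ S → x i = 0 := fun i hi =>
    congrFun (LinearMap.mem_ker.1 hxS) (⟨i, not_not.1 hi⟩ : S)
  refine (h x hxC ?_).trans (hammingNorm_comp_val x hx).ge
  rintro rfl
  exact h0 (map_zero _)

/-- Rank-nullity for restriction to `S`: the kernel consists of the codewords vanishing on `S`, and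
deleting `S` is injective on them. -/
theorem finrank_shortenOn_add [DecidableEq ι] (C : Submodule (ZMod 2) (ι → ZMod 2)) (S : Finset ι) :
    Module.finrank (ZMod 2) (shortenOn C S) + Module.finrank (ZMod 2)
      (C.map (LinearMap.funLeft (ZMod 2) (ZMod 2) (Subtype.val : S → ι))) =
      Module.finrank (ZMod 2) C := by
  set f := LinearMap.funLeft (ZMod 2) (ZMod 2) (Subtype.val : S → ι)
  set g := LinearMap.funLeft (ZMod 2) (ZMod 2) (Subtype.val : {i : ι // i ∉ S} → ι)
  have hg : Module.finrank (ZMod 2) (shortenOn C S) =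
      Module.finrank (ZMod 2) (C ⊓ LinearMap.ker f : Submodule (ZMod 2) (ι → ZMod 2)) := by
    rw [BinaryCode.shortenOn, ← LinearMap.range_domRestrict]
    refine LinearMap.finrank_range_of_inj (LinearMap.ker_eq_bot.1 (LinearMap.ker_eq_bot'.2 ?_))
    rintro ⟨x, hxC, hxS⟩ hx
    ext i
    by_cases hi : i ∈ S
    · exact congrFun (LinearMap.mem_ker.1 hxS) (⟨i, hi⟩ : S)
    · exact congrFun hx ⟨i, hi⟩
  have hf := LinearMap.finrank_range_add_finrank_ker (f.domRestrict C)
  rw [LinearMap.range_domRestrict] at hf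
  have hk : Module.finrank (ZMod 2) (LinearMap.ker (f.domRestrict C)) =
      Module.finrank (ZMod 2) (C ⊓ LinearMap.ker f : Submodule (ZMod 2) (ι → ZMod 2)) := by
    rw [LinearMap.ker_domRestrict, ← Submodule.map_comap_subtype, Submodule.finrank_map_subtype_eq]
  omega

theorem finrank_le_finrank_shortenOn_add [DecidableEq ι] (C : Submodule (ZMod 2) (ι → ZMod 2))
    (S : Finset ι) :
    Module.finrank (ZMod 2) C ≤ Module.finrank (ZMod 2) (shortenOn C S) + S.card := by
  have h1 := finrank_shortenOn_add C S
  have h2 := Submodule.finrank_le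
    (C.map (LinearMap.funLeft (ZMod 2) (ZMod 2) (Subtype.val : S → ι)))
  rw [Module.finrank_pi, Fintype.card_coe] at h2
  omega

/-- On the support of a dual word `u`, the restrictions of codewords all satisfy the parity check
`u`. They form a proper subspace, so shortening there costs at least one dimension less than the
weight of `u`. -/
theorem finrank_lt_finrank_shortenOn_add [DecidableEq ι] (C : Submodule (ZMod 2) (ι → ZMod 2))
    {u : ι → ZMod 2} (hu : u ∈ dual C) (hu0 : u ≠ 0) :
    Module.finrank (ZMod 2) C <
      Module.finrank (ZMod 2) (shortenOn C {i | u i ≠ 0}) + hammingNorm u := by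
  set S : Finset ι := {i | u i ≠ 0} with hS
  have h1 := finrank_shortenOn_add C S
  have h2 : Module.finrank (ZMod 2)
      (C.map (LinearMap.funLeft (ZMod 2) (ZMod 2) (Subtype.val : S → ι))) < S.card := by
    rw [← Fintype.card_coe, ← Module.finrank_pi (ZMod 2)]
    refine Submodule.finrank_lt fun htop => ?_
    obtain ⟨i, hi⟩ := Function.ne_iff.1 hu0
    have hiS : i ∈ S := by simpa [hS] using hi
    -- If the restriction were onto, some codeword would restrict to a unit vector on the support,
    -- and its product with `u` would be `u i ≠ 0`.
    obtain ⟨x, hx, hxi⟩ : Pi.single (⟨i, hiS⟩ : S) (1 : ZMod 2) ∈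
      C.map (LinearMap.funLeft (ZMod 2) (ZMod 2) (Subtype.val : S → ι)) := htop ▸ trivial
    have h3 := hu x hx
    rw [dotProduct, Finset.sum_eq_single i] at h3
    · have h4 : x i = 1 := by simpa using congrFun hxi ⟨i, hiS⟩
      rw [h4, mul_one] at h3
      exact hi h3
    · intro j _ hj
      by_cases hjS : j ∈ S
      · have h4 : x j = 0 := by
          have := congrFun hxi ⟨j, hjS⟩
          rwa [Pi.single_eq_of_ne (by simpa [Subtype.ext_iff] using hj)] at this
        rw [h4, mul_zero]
      · have : u j = 0 := by simpa [hS] using hjS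
        rw [this, zero_mul]
    · simp
  have h3 : hammingNorm u = S.card := rfl
  omega

theorem card_compl_finset [DecidableEq ι] (S : Finset ι) :
    Fintype.card {i : ι // i ∉ S} = Fintype.card ι - S.card := by
  simp

theorem weightCount_card_le_one (C : Submodule (ZMod 2) (ι → ZMod 2)) :
    weightCount C (Fintype.card ι) ≤ 1 := by
  rw [weightCount, Finite.card_le_one_iff_subsingleton]
  have hone : ∀ x : ι → ZMod 2, hammingNorm x = Fintype.card ι → x = 1 := by
    intro x hx
    ext i
    have h : ({i | x i ≠ 0} : Finset ι) = Finset.univ := (Finset.card_eq_iff_eq_univ _).1 hx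
    have hi : x i ≠ 0 := by simpa using h.ge (Finset.mem_univ i)
    have : ∀ a : ZMod 2, a ≠ 0 → a = 1 := by decide
    simp [this _ hi]
  exact ⟨fun x y => Subtype.ext ((hone _ x.2.2).trans (hone _ y.2.2).symm)⟩

theorem finrank_le_four_of_twelve {C : Submodule (ZMod 2) (ι → ZMod 2)}
    (hn : Fintype.card ι = 12) (hC : WeightGE C 5) : Module.finrank (ZMod 2) C ≤ 4 := by
  classical
  have h5 : Module.finrank (ZMod 2) C ≤ 5 :=
    finrank_le_of_lpCertificate [72, 48, 17, 3, 0, 0, 0, 0, 0, 0, 3, 17, 48]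
      (by decide +kernel) hn hC
  by_contra hlt
  have hk : Module.finrank (ZMod 2) C = 5 := by omega
  -- A dual word of weight 1, 2 or 3 would give a shortened code of length 11, 10 or 9 and dimension
  -- at least 5, 4 or 3, each excluded by linear programming.
  have hdual : WeightGE (dual C) 4 := by
    intro u hu hu0
    have h1 := finrank_lt_finrank_shortenOn_add C hu hu0
    have h2 : 0 < hammingNorm u := hammingNorm_pos_iff.2 hu0
    have h3 := hC.shortenOn {i | u i ≠ 0}
    have h4 := card_compl_finset ({i | u i ≠ 0} : Finset ι)
    rw [hn, show Finset.card {i | u i ≠ 0} = hammingNorm u from rfl] at h4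
    by_contra h
    have : hammingNorm u = 1 ∨ hammingNorm u = 2 ∨ hammingNorm u = 3 := by omega
    rcases this with h | h | h
    · have := finrank_le_of_lpCertificate (n := 11) (d := 5) (k := 4)
        [1, 1, 0, 0, 0, 0, 0, 0, 0, 0, 1, 1] (by decide +kernel)
        (h4.trans (by rw [h])) h3
      omega
    · have := finrank_le_of_lpCertificate (n := 10) (d := 5) (k := 3)
        [1, 1, 0, 0, 0, 0, 0, 0, 0, 0, 1] (by decide +kernel)
        (h4.trans (by rw [h])) h3
      omega
    · have := finrank_le_of_lpCertificate (n := 9) (d := 5) (k := 2)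
        [2, 1, 0, 0, 0, 0, 0, 0, 0, 1] (by decide +kernel)
        (h4.trans (by rw [h])) h3
      omega
  have hM := macWilliams C
  have hcard : Nat.card C = 32 := by rw [natCard_eq_two_pow, hk]; rfl
  simp only [hn, hcard, Finset.sum_range_succ, Finset.sum_range_zero, weightCount_zero,
    hC.weightCount_eq_zero (w := 1) (by decide) (by decide),
    hC.weightCount_eq_zero (w := 2) (by decide) (by decide),
    hC.weightCount_eq_zero (w := 3) (by decide) (by decide),
    hC.weightCount_eq_zero (w := 4) (by decide) (by decide)] at hM
  have m0 := hM 0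
  have m1 := hM 1
  have m2 := hM 2
  have m3 := hM 3
  -- Since `K_12(w) = (-1) ^ w`, this identity compares the numbers of even and odd words.
  have m12 := hM 12
  rw [weightCount_zero] at m0
  rw [hdual.weightCount_eq_zero (by decide) (by decide)] at m1 m2 m3
  norm_num [kraw, Finset.sum_range_succ, Nat.choose] at m0 m1 m2 m3 m12
  have h12 : weightCount (dual C) 12 ≤ 1 := by
    rw [← hn]
    exact weightCount_card_le_one _
  have a12 : weightCount C 12 ≤ 1 := by
    rw [← hn]
    exact weightCount_card_le_one _
  have a11 : weightCount C 11 ≤ 1 := by omega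
  have a10 : weightCount C 10 ≤ 2 := by omega
  -- With `B_12`, `A_12`, `A_11` and `A_10` fixed, the five identities determine `A_5, …, A_9`; no
  -- choice makes all of them natural numbers.
  interval_cases weightCount (dual C) 12 <;> interval_cases weightCount C 12 <;>
    interval_cases weightCount C 11 <;> interval_cases weightCount C 10 <;> omega

/-! ### Puncturing and shortening -/

theorem hammingNorm_deleteCoord_of_eq_zero [DecidableEq ι] {p : ι} {x : ι → ZMod 2} (hx : x p = 0) :
    hammingNorm (deleteCoord p x) = hammingNorm x :=
  hammingNorm_comp_val x fun i hi => by rw [not_not.1 hi, hx]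

theorem hammingNorm_deleteCoord_of_ne_zero [DecidableEq ι] {p : ι} {x : ι → ZMod 2} (hx : x p ≠ 0) :
    hammingNorm (deleteCoord p x) + 1 = hammingNorm x := by
  have h : deleteCoord p x = deleteCoord p (Function.update x p 0) := by
    ext i
    simp [deleteCoord, LinearMap.funLeft_apply, i.2]
  rw [h, hammingNorm_deleteCoord_of_eq_zero (by simp)]
  unfold hammingNorm
  rw [← Finset.card_insert_of_notMem (a := p) (by simp)]
  congr 1
  ext i
  by_cases hip : i = p
  · simp [hip, hx]
  · simp [hip]

theorem hammingNorm_le_deleteCoord_add_one [DecidableEq ι] (p : ι) (x : ι → ZMod 2) :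
    hammingNorm x ≤ hammingNorm (deleteCoord p x) + 1 := by
  by_cases hx : x p = 0
  · rw [hammingNorm_deleteCoord_of_eq_zero hx]
    omega
  · rw [hammingNorm_deleteCoord_of_ne_zero hx]

/-- Insertion of the value `0` at the coordinate `p`. -/
def insertZero {α : Type*} [DecidableEq α] {p : α} (u : {i : α // i ≠ p} → ZMod 2) : α → ZMod 2 :=
  fun i => if h : i = p then 0 else u ⟨i, h⟩

theorem insertZero_self {α : Type*} [DecidableEq α] {p : α} (u : {i : α // i ≠ p} → ZMod 2) :
    insertZero u p = 0 := dif_pos rfl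

theorem deleteCoord_insertZero {α : Type*} [DecidableEq α] {p : α}
    (u : {i : α // i ≠ p} → ZMod 2) : deleteCoord p (insertZero u) = u := by
  ext i
  simp [deleteCoord, LinearMap.funLeft_apply, insertZero, i.2]

theorem deleteCoord_dotProduct [DecidableEq ι] {p : ι} {u : ι → ZMod 2} (hu : u p = 0)
    (x : ι → ZMod 2) : deleteCoord p u ⬝ᵥ deleteCoord p x = u ⬝ᵥ x := by
  have h := Fintype.sum_subtype_add_sum_subtype (fun i => i ≠ p) fun i => u i * x i
  rw [Finset.sum_eq_zero (s := (Finset.univ : Finset {i // ¬ i ≠ p}))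
    (fun i _ => by rw [not_not.1 i.2, hu, zero_mul]), add_zero] at h
  exact h

/-- A word on the remaining coordinates is orthogonal to the punctured code exactly when its
extension by 0 at `p` is orthogonal to `C`. -/
theorem dual_puncture [DecidableEq ι] (C : Submodule (ZMod 2) (ι → ZMod 2)) (p : ι) :
    dual (puncture C p) = shorten (dual C) p := by
  ext u
  constructor
  · intro hu
    refine ⟨insertZero u, ⟨fun x hx => ?_, ?_⟩, deleteCoord_insertZero u⟩
    · rw [← deleteCoord_dotProduct (insertZero_self u), deleteCoord_insertZero]
      exact hu _ ⟨x, hx, rfl⟩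
    · exact insertZero_self u
  · rintro ⟨v, ⟨hv, hvp⟩, rfl⟩ _ ⟨x, hx, rfl⟩
    rw [deleteCoord_dotProduct (by simpa using hvp)]
    exact hv x hx

theorem WeightGE.shorten [DecidableEq ι] {C : Submodule (ZMod 2) (ι → ZMod 2)} {d : ℕ}
    (h : WeightGE C d) (p : ι) : WeightGE (shorten C p) d := by
  rintro _ ⟨x, ⟨hx, hxp⟩, rfl⟩ hx0
  rw [hammingNorm_deleteCoord_of_eq_zero (by simpa using hxp)]
  refine h x hx ?_
  rintro rfl
  exact hx0 (map_zero _)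

theorem WeightGE.puncture [DecidableEq ι] {C : Submodule (ZMod 2) (ι → ZMod 2)} {d : ℕ}
    (h : WeightGE C (d + 1)) (p : ι) : WeightGE (puncture C p) d := by
  rintro _ ⟨x, hx, rfl⟩ hx0
  have h1 := hammingNorm_le_deleteCoord_add_one p x
  have h2 := h x hx (by rintro rfl; exact hx0 (map_zero _))
  omega

theorem finrank_puncture [DecidableEq ι] {C : Submodule (ZMod 2) (ι → ZMod 2)}
    (h : WeightGE C 2) (p : ι) :
    Module.finrank (ZMod 2) (puncture C p) = Module.finrank (ZMod 2) C := by
  rw [BinaryCode.puncture, ← LinearMap.range_domRestrict]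
  refine LinearMap.finrank_range_of_inj (LinearMap.ker_eq_bot.1 (LinearMap.ker_eq_bot'.2 ?_))
  rintro ⟨x, hx⟩ hx0
  by_contra hne
  have h1 := hammingNorm_le_deleteCoord_add_one p x
  have h2 := h x hx fun h0 => hne (Subtype.ext h0)
  have h3 : deleteCoord p x = 0 := hx0
  rw [h3, hammingNorm_zero] at h1
  omega

/-! ### Nonexistence -/

/-- There is no code of length `n` with minimum distance at least `d` and dual distance at
least `e`. -/
def NoCode (d e n : ℕ) : Prop :=
  ∀ (ι : Type) [Fintype ι] (C : Submodule (ZMod 2) (ι → ZMod 2)), Fintype.card ι = n →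
    d ≤ minDist C → ¬ e ≤ minDist (dual C)

theorem NoCode.mono {d e d' e' n : ℕ} (h : NoCode d e n) (hd : d ≤ d') (he : e ≤ e') :
    NoCode d' e' n :=
  fun ι _ C hn hC hC' => h ι C hn (hd.trans hC) (he.trans hC')

theorem noCode_of_finrank_le {d e n a b : ℕ} (hd : 1 ≤ d) (he : 1 ≤ e)
    (ha : ∀ (ι : Type) [Fintype ι] (C : Submodule (ZMod 2) (ι → ZMod 2)), Fintype.card ι = n →
      WeightGE C d → Module.finrank (ZMod 2) C ≤ a)
    (hb : ∀ (ι : Type) [Fintype ι] (C : Submodule (ZMod 2) (ι → ZMod 2)), Fintype.card ι = n →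
      WeightGE C e → Module.finrank (ZMod 2) C ≤ b)
    (hab : a + b < n) : NoCode d e n := by
  intro ι _ C hn hC hC'
  have h1 := ha ι C hn ((le_minDist_iff hd).1 hC).2
  have h2 := hb ι _ hn ((le_minDist_iff he).1 hC').2
  have h3 := finrank_add_finrank_dual C
  omega

theorem noCode_of_lpCertificate {d e n : ℕ} (a b : ℕ) (f g : List ℕ)
    (hf : lpCertificate n d (2 ^ (a + 1)) f = true) (hg : lpCertificate n e (2 ^ (b + 1)) g = true)
    (hd : 1 ≤ d) (he : 1 ≤ e) (hab : a + b < n) : NoCode d e n :=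
  noCode_of_finrank_le hd he (fun _ _ _ hn hC => finrank_le_of_lpCertificate f hf hn hC)
    (fun _ _ _ hn hC => finrank_le_of_lpCertificate g hg hn hC) hab

theorem noCode_zero {d e : ℕ} (hd : 1 ≤ d) : NoCode d e 0 := by
  intro ι _ C hn hC _
  have := Fintype.card_eq_zero_iff.1 hn
  exact ((le_minDist_iff hd).1 hC).1 (Subsingleton.elim _ _)

/-- Puncturing any coordinate keeps distance at least `d`, while the dual is shortened and keeps
distance at least `e`. What remains is that neither resulting code is zero. -/
theorem NoCode.succ {d e n : ℕ} (h : NoCode d e n) (hd : 2 ≤ d) (he : 1 ≤ e) :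
    NoCode (d + 1) e (n + 1) := by
  classical
  intro ι _ C hn hC hC'
  obtain ⟨hC0, hCd⟩ := (le_minDist_iff (by omega)).1 hC
  obtain ⟨-, hCe⟩ := (le_minDist_iff he).1 hC'
  obtain ⟨p⟩ : Nonempty ι := Fintype.card_pos_iff.1 (by omega)
  have hcard : Fintype.card {i : ι // i ≠ p} = n := by
    rw [Fintype.card_subtype_compl, Fintype.card_subtype_eq, hn, Nat.add_sub_cancel]
  have hP := hCd.puncture p
  refine h _ (puncture C p) hcard ((le_minDist_iff (by omega)).2 ⟨fun h0 => hC0 ?_, hP⟩)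
    ((le_minDist_iff he).2 ⟨fun h0 => ?_, by rw [dual_puncture]; exact hCe.shorten p⟩)
  · rw [← Submodule.finrank_eq_zero (R := ZMod 2), finrank_puncture (hCd.mono (by omega))] at h0
    exact Submodule.finrank_eq_zero.1 h0
  · have htop : puncture C p = ⊤ := by
      rw [← dual_dual (puncture C p), h0, eq_top_iff]
      intro x _ y hy
      rw [(Submodule.mem_bot _).1 hy, dotProduct_zero]
    obtain ⟨q⟩ : Nonempty {i : ι // i ≠ p} := by
      by_contra hne
      rw [not_nonempty_iff] at hne
      have h1 := finrank_puncture (hCd.mono (by omega : 2 ≤ d + 1)) p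
      rw [Module.finrank_zero_of_subsingleton] at h1
      exact hC0 (Submodule.finrank_eq_zero.1 h1.symm)
    -- A zero dual would make the punctured code the whole space, which contains a word of weight 1,
    -- less than `d`.
    have h1 := hP (Pi.single q 1) (htop ▸ trivial) (by simp)
    have h2 : hammingNorm (Pi.single q 1 : {i : ι // i ≠ p} → ZMod 2) ≤ 1 := by
      unfold hammingNorm
      refine (Finset.card_le_card (t := {q}) fun i hi => ?_).trans (Finset.card_singleton q).le
      by_contra hiq
      exact (Finset.mem_filter.1 hi).2 (Pi.single_eq_of_ne (by simpa using hiq) _)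
    omega

theorem noCode_three_three {n : ℕ} (h : n < 6) : NoCode 3 3 n := by
  interval_cases n
  · exact noCode_zero (by decide)
  -- For lengths below 3 no weight is admissible, so the constant polynomial already shows that the
  -- code is zero.
  · exact noCode_of_lpCertificate 0 0 [1] [1] (by decide +kernel) (by decide +kernel)
      (by decide) (by decide) (by decide)
  · exact noCode_of_lpCertificate 0 0 [1] [1] (by decide +kernel) (by decide +kernel)
      (by decide) (by decide) (by decide)
  · exact noCode_of_lpCertificate 1 1 [3, 1] [3, 1] (by decide +kernel) (by decide +kernel)
      (by decide) (by decide) (by decide)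
  · exact noCode_of_lpCertificate 1 1 [3, 1, 0, 0, 1] [3, 1, 0, 0, 1] (by decide +kernel)
      (by decide +kernel) (by decide) (by decide) (by decide)
  · exact noCode_of_lpCertificate 2 2 [2, 1, 0, 0, 0, 1] [2, 1, 0, 0, 0, 1] (by decide +kernel)
      (by decide +kernel) (by decide) (by decide) (by decide)

theorem noCode_five_three {n : ℕ} (h : n < 11) : NoCode 5 3 n := by
  rcases lt_or_ge n 6 with h6 | h6
  · exact (noCode_three_three h6).mono (by decide) le_rfl
  interval_cases n
  · exact noCode_of_lpCertificate 1 3 [5, 1, 0, 0, 0, 0, 1] [1, 1, 0, 0, 0, 0, 1]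
      (by decide +kernel) (by decide +kernel) (by decide) (by decide) (by decide)
  · exact noCode_of_lpCertificate 1 4 [4, 1, 0, 0, 0, 0, 0, 1] [3, 3, 1, 0, 0, 0, 0, 3]
      (by decide +kernel) (by decide +kernel) (by decide) (by decide) (by decide)
  · exact noCode_of_lpCertificate 2 4 [3, 1, 0, 0, 0, 0, 0, 0, 1] [10, 6, 3, 1, 0, 0, 1, 3, 6]
      (by decide +kernel) (by decide +kernel) (by decide) (by decide) (by decide)
  · exact noCode_of_lpCertificate 2 5 [2, 1, 0, 0, 0, 0, 0, 0, 0, 1] [6, 4, 2, 1, 0, 0, 0, 1, 2, 4]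
      (by decide +kernel) (by decide +kernel) (by decide) (by decide) (by decide)
  · exact noCode_of_lpCertificate 3 6 [1, 1, 0, 0, 0, 0, 0, 0, 0, 0, 1]
      [3, 3, 1, 1, 0, 0, 0, 0, 1, 1, 3]
      (by decide +kernel) (by decide +kernel) (by decide) (by decide) (by decide)

theorem noCode_five_four {n : ℕ} (h : n < 13) : NoCode 5 4 n := by
  rcases lt_or_ge n 11 with h11 | h11
  · exact (noCode_five_three h11).mono le_rfl (by decide)
  interval_cases n
  · exact noCode_of_lpCertificate 4 6 [1, 1, 0, 0, 0, 0, 0, 0, 0, 0, 1, 1]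
      [405, 320, 152, 78, 0, 0, 0, 17, 23]
      (by decide +kernel) (by decide +kernel) (by decide) (by decide) (by decide)
  -- Length 12 needs the refined bound 4, since `5 + 7` would not be less than 12.
  · exact noCode_of_finrank_le (a := 4) (b := 7) (by decide) (by decide)
      (fun _ _ _ hn hC => finrank_le_four_of_twelve hn hC)
      (fun _ _ _ hn hC => finrank_le_of_lpCertificate [117, 117, 52, 36, 6, 0, 0, 0, 7, 3]
        (by decide +kernel) hn hC) (by decide)

/-- Shortening at `n - 12` coordinates costs at most `n - 12` dimensions and leaves a code of length
12, of dimension at most 4. -/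
theorem finrank_add_eight_le {C : Submodule (ZMod 2) (ι → ZMod 2)}
    (hn : 12 ≤ Fintype.card ι) (hC : WeightGE C 5) :
    Module.finrank (ZMod 2) C + 8 ≤ Fintype.card ι := by
  classical
  obtain ⟨S, -, hS⟩ := Finset.exists_subset_card_eq (s := (Finset.univ : Finset ι))
    (n := Fintype.card ι - 12) (by simp)
  have h1 := finrank_le_four_of_twelve (by rw [card_compl_finset, hS]; omega) (hC.shortenOn S)
  have h2 := finrank_le_finrank_shortenOn_add C S
  omega

theorem noCode_five_five {n : ℕ} (h : n < 16) : NoCode 5 5 n := by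
  rcases lt_or_ge n 13 with h13 | h13
  · exact (noCode_five_four h13).mono le_rfl (by decide)
  intro ι _ C hn hC hC'
  have h1 := finrank_add_eight_le (by omega) ((le_minDist_iff (by decide)).1 hC).2
  have h2 := finrank_add_eight_le (by omega) ((le_minDist_iff (by decide)).1 hC').2
  have h3 := finrank_add_finrank_dual C
  omega

theorem noCode_seven_three {n : ℕ} (h : n < 14) : NoCode 7 3 n := by
  rcases lt_or_ge n 11 with h11 | h11
  · exact (noCode_five_three h11).mono (by decide) le_rfl
  interval_cases n
  · exact noCode_of_lpCertificate 2 7 [4, 1, 0, 0, 0, 0, 0, 0, 0, 0, 0, 1]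
      [15, 15, 7, 5, 2, 0, 0, 0, 1, 5, 5, 15]
      (by decide +kernel) (by decide +kernel) (by decide) (by decide) (by decide)
  · exact noCode_of_lpCertificate 2 8 [3, 1, 0, 0, 0, 0, 0, 0, 0, 0, 0, 0, 1]
      [21, 15, 10, 6, 3, 1, 0, 0, 1, 3, 6, 10, 15]
      (by decide +kernel) (by decide +kernel) (by decide) (by decide) (by decide)
  · exact noCode_of_lpCertificate 3 9 [2, 1, 0, 0, 0, 0, 0, 0, 0, 0, 0, 0, 0, 1]
      [12, 9, 6, 4, 2, 1, 0, 0, 0, 1, 2, 4, 6, 9]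
      (by decide +kernel) (by decide +kernel) (by decide) (by decide) (by decide)

theorem noCode_seven_four {n : ℕ} (h : n < 15) : NoCode 7 4 n := by
  rcases lt_or_ge n 14 with h14 | h14
  · exact (noCode_seven_three h14).mono le_rfl (by decide)
  interval_cases n
  exact noCode_of_lpCertificate 4 9 [1, 1, 0, 0, 0, 0, 0, 0, 0, 0, 0, 0, 0, 0, 1]
    [1092, 819, 540, 329, 154, 62, 0, 0, 0, 29, 28, 35, 6]
    (by decide +kernel) (by decide +kernel) (by decide) (by decide) (by decide)

theorem noCode_succ_of_forall_lt {d e m : ℕ} (h : ∀ n < m, NoCode d e n) (hd : 2 ≤ d)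
    (he : 1 ≤ e) {n : ℕ} (hn : n < m + 1) : NoCode (d + 1) e n := by
  cases n with
  | zero => exact noCode_zero (by omega)
  | succ n => exact (h n (by omega)).succ hd he

theorem NoCode.symm {d e n : ℕ} (h : NoCode d e n) : NoCode e d n := by
  intro ι _ C hn hC hC'
  exact h ι (dual C) hn hC' (by rwa [dual_dual])

/-! ### Attained values of `N` -/

/-- The code `C` with its coordinates renamed along `f`. -/
def reindexCode {α β : Type*} (f : α ≃ β) (C : Submodule (ZMod 2) (α → ZMod 2)) :
    Submodule (ZMod 2) (β → ZMod 2) :=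
  C.comap (LinearMap.funLeft (ZMod 2) (ZMod 2) f)

theorem minDist_reindexCode (f : ι ≃ κ) (C : Submodule (ZMod 2) (ι → ZMod 2)) :
    minDist (reindexCode f C) = minDist C := by
  have hdist : ∀ x y : κ → ZMod 2, hammingDist (x ∘ f) (y ∘ f) = hammingDist x y := by
    intro x y
    unfold hammingDist
    refine Finset.card_bij (fun i _ => f i) (fun i hi => by simpa using hi)
      (fun i _ j _ h => f.injective h) fun j hj => ⟨f.symm j, by simpa using hj, by simp⟩
  unfold minDist
  congr 1
  ext w
  constructor
  · rintro ⟨x, hx, y, hy, hxy, rfl⟩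
    exact ⟨x ∘ f, hx, y ∘ f, hy, fun h => hxy (f.surjective.injective_comp_right h), hdist x y⟩
  · rintro ⟨x, hx, y, hy, hxy, rfl⟩
    have hinv : ∀ z : ι → ZMod 2, (z ∘ f.symm) ∘ f = z := fun z => by ext i; simp
    refine ⟨x ∘ f.symm, ?_, y ∘ f.symm, ?_, fun h => hxy ?_, ?_⟩
    · exact (congrArg (· ∈ C) (hinv x)).mpr hx
    · exact (congrArg (· ∈ C) (hinv y)).mpr hy
    · exact f.symm.surjective.injective_comp_right h
    · rw [← hdist, hinv, hinv]

theorem dual_reindexCode (f : ι ≃ κ) (C : Submodule (ZMod 2) (ι → ZMod 2)) :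
    dual (reindexCode f C) = reindexCode f (dual C) := by
  ext u
  constructor
  · intro hu x hx
    have h := hu (x ∘ f.symm) (show (x ∘ f.symm) ∘ f ∈ C by
      rwa [Function.comp_assoc, f.symm_comp_self, Function.comp_id])
    rwa [dotProduct_comp_equiv_symm] at h
  · intro hu x hx
    have h := hu (x ∘ f) hx
    rw [← h]
    exact (comp_equiv_dotProduct_comp_equiv u x f).symm

theorem N_eq {d e n m : ℕ} {α : Type} [Fintype α] {C : Submodule (ZMod 2) (α → ZMod 2)}
    (hC : HasParameters C n m d e) (h : ∀ n' < n, NoCode d e n') : N d e = n := by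
  have hmem : n ∈ {n : ℕ | ∃ C : Submodule (ZMod 2) (Fin n → ZMod 2),
      d ≤ minDist C ∧ e ≤ minDist (dual C)} := by
    refine ⟨reindexCode (Fintype.equivFinOfCardEq hC.length_eq) C, ?_, ?_⟩
    · rw [minDist_reindexCode, hC.minDist_eq]
    · rw [dual_reindexCode, minDist_reindexCode, hC.dualDist_eq]
  refine le_antisymm (Nat.sInf_le hmem) (le_csInf ⟨n, hmem⟩ ?_)
  rintro n' ⟨D, hD, hD'⟩
  by_contra hlt
  exact h n' (not_le.1 hlt) (Fin n') D (Fintype.card_fin n') hD hD'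

/-! ### Parameters of codes given by matrices -/

theorem HasParameters.dual {C : Submodule (ZMod 2) (ι → ZMod 2)} {n m k d e : ℕ}
    (h : HasParameters C n m d e) (hmk : m + k = n) : HasParameters (dual C) n k e d where
  length_eq := h.length_eq
  finrank_eq := by
    have h1 := finrank_add_finrank_dual C
    rw [h.finrank_eq, h.length_eq] at h1
    omega
  minDist_eq := h.dualDist_eq
  dualDist_eq := by rw [dual_dual, h.minDist_eq]

theorem mem_rowCode {α : Type*} {G : Matrix κ α (ZMod 2)} {x : α → ZMod 2} :
    x ∈ rowCode G ↔ ∃ m, Matrix.vecMul m G = x := by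
  rw [rowCode, ← range_vecMulLinear]
  rfl

theorem dual_rowCode {α : Type*} (G : Matrix α ι (ZMod 2)) :
    dual (rowCode G) = LinearMap.ker G.mulVecLin := by
  ext u
  rw [LinearMap.mem_ker, Matrix.mulVecLin_apply]
  constructor
  · intro h
    ext i
    rw [Matrix.mulVec, dotProduct_comm]
    exact h _ (Submodule.subset_span ⟨i, rfl⟩)
  · intro h v hv
    have hle : rowCode G ≤ dual (Submodule.span (ZMod 2) {u}) := by
      refine Submodule.span_le.2 ?_
      rintro _ ⟨i, rfl⟩ w hw
      obtain ⟨c, rfl⟩ := Submodule.mem_span_singleton.1 hw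
      rw [dotProduct_smul]
      exact (congrArg (c • ·) (congrFun h i)).trans (smul_zero c)
    rw [dotProduct_comm]
    exact hle hv u (Submodule.mem_span_singleton_self u)

theorem finrank_rowCode_of_weight [DecidableEq κ] {G : Matrix κ ι (ZMod 2)} {d : ℕ} (hd : 1 ≤ d)
    (h : ∀ m, m ≠ 0 → d ≤ hammingNorm (Matrix.vecMul m G)) :
    Module.finrank (ZMod 2) (rowCode G) = Fintype.card κ := by
  rw [rowCode, ← range_vecMulLinear, LinearMap.finrank_range_of_inj, Module.finrank_pi]
  refine LinearMap.ker_eq_bot.1 (LinearMap.ker_eq_bot'.2 fun m hm => ?_)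
  by_contra hm0
  have h1 := h m hm0
  rw [show Matrix.vecMul m G = 0 from hm, hammingNorm_zero] at h1
  omega

theorem weightGE_rowCode {G : Matrix κ ι (ZMod 2)} {d : ℕ}
    (h : ∀ m, m ≠ 0 → d ≤ hammingNorm (Matrix.vecMul m G)) : WeightGE (rowCode G) d := by
  intro x hx hx0
  obtain ⟨m, rfl⟩ := mem_rowCode.1 hx
  exact h m (by rintro rfl; exact hx0 (Matrix.zero_vecMul G))

theorem hasParameters_rowCode [DecidableEq κ] {G : Matrix κ ι (ZMod 2)} {n k d e : ℕ}
    (hn : Fintype.card ι = n) (hk : Fintype.card κ = k) (hd : 1 ≤ d) (he : 1 ≤ e)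
    (hG : ∀ m, m ≠ 0 → d ≤ hammingNorm (Matrix.vecMul m G)) (hGd : ∃ i, hammingNorm (G i) = d)
    (hker : WeightGE (LinearMap.ker G.mulVecLin) e)
    (hkere : ∃ u, Matrix.mulVec G u = 0 ∧ hammingNorm u = e) :
    HasParameters (rowCode G) n k d e where
  length_eq := hn
  finrank_eq := (finrank_rowCode_of_weight hd hG).trans hk
  minDist_eq := by
    obtain ⟨i, hi⟩ := hGd
    exact minDist_eq_of_weightGE hd (weightGE_rowCode hG)
      ⟨G i, Submodule.subset_span ⟨i, rfl⟩, hi⟩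
  dualDist_eq := by
    rw [dual_rowCode]
    exact minDist_eq_of_weightGE he hker hkere

/-- The weight conditions make the rows of `G` and of `H` independent. Orthogonality and the count
`k + k' = n` then force the kernel of `G` to be the row space of `H`, so the dual distance can be
read off the rows of `H`. -/
theorem hasParameters_rowCode_of_parityCheck {κ' : Type*} [Fintype κ'] [DecidableEq κ]
    [DecidableEq κ'] {G : Matrix κ ι (ZMod 2)} {H : Matrix κ' ι (ZMod 2)} {n k d e : ℕ}
    (hGH : G * H.transpose = 0)
    (hn : Fintype.card ι = n) (hk : Fintype.card κ = k) (hkn : k + Fintype.card κ' = n)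
    (hd : 1 ≤ d) (he : 1 ≤ e)
    (hG : ∀ m, m ≠ 0 → d ≤ hammingNorm (Matrix.vecMul m G)) (hGd : ∃ i, hammingNorm (G i) = d)
    (hH : ∀ m, m ≠ 0 → e ≤ hammingNorm (Matrix.vecMul m H)) (hHe : ∃ i, hammingNorm (H i) = e) :
    HasParameters (rowCode G) n k d e := by
  have hrow : ∀ i, Matrix.mulVec G (H i) = 0 := fun i => by
    ext j
    exact congrFun (congrFun hGH j) i
  obtain ⟨i, hi⟩ := hHe
  refine hasParameters_rowCode hn hk hd he hG hGd ?_ ⟨H i, hrow i, hi⟩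
  have hle : rowCode H ≤ LinearMap.ker G.mulVecLin := by
    refine Submodule.span_le.2 ?_
    rintro _ ⟨i, rfl⟩
    exact hrow i
  have h1 := finrank_add_finrank_dual (rowCode G)
  rw [finrank_rowCode_of_weight hd hG, dual_rowCode] at h1
  rw [← Submodule.eq_of_le_of_finrank_eq hle
    (by rw [finrank_rowCode_of_weight he hH]; omega)]
  exact weightGE_rowCode hH

/-! ### Words as natural numbers -/

/-- The binary word of length `n` whose coordinates are the binary digits of `a`. -/
def toWord (n a : ℕ) : Fin n → ZMod 2 := fun i => if a.testBit i then 1 else 0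

theorem toWord_xor (n a b : ℕ) : toWord n (a ^^^ b) = toWord n a + toWord n b := by
  ext i
  simp only [toWord, Nat.testBit_xor, Pi.add_apply]
  cases a.testBit i <;> cases b.testBit i <;> decide

/-- The number of digits `1` among the first `n` binary digits of `a`. -/
def digitCount : ℕ → ℕ → ℕ
  | 0, _ => 0
  | n + 1, a => a % 2 + digitCount n (a / 2)

theorem hammingNorm_toWord (n a : ℕ) : hammingNorm (toWord n a) = digitCount n a := by
  induction n generalizing a with
  | zero => rfl
  | succ n ih =>
    rw [digitCount, ← ih, hammingNorm, hammingNorm, Finset.card_filter, Finset.card_filter,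
      Fin.sum_univ_succ]
    congr 1
    · rcases Nat.mod_two_eq_zero_or_one a with h | h <;> simp [toWord, h]
    · refine Finset.sum_congr rfl fun i _ => ?_
      simp [toWord, Nat.testBit_succ]

/-- The matrix whose rows are the binary digits of the members of `l`. -/
def bitMatrix (n : ℕ) (l : List ℕ) : Matrix (Fin l.length) (Fin n) (ZMod 2) :=
  Matrix.of fun i => toWord n l[i]

/-- The bitwise sums over all nonempty sublists of `l`. -/
def xorSums : List ℕ → List ℕ
  | [] => []
  | a :: l => xorSums l ++ a :: (xorSums l).map (a ^^^ ·)

theorem vecMul_bitMatrix_mem (n : ℕ) (l : List ℕ) (m : Fin l.length → ZMod 2) (hm : m ≠ 0) :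
    ∃ c ∈ xorSums l, Matrix.vecMul m (bitMatrix n l) = toWord n c := by
  induction l with
  | nil => exact absurd (funext fun i => i.elim0) hm
  | cons a l ih =>
    have hsplit : Matrix.vecMul m (bitMatrix n (a :: l)) =
        m 0 • toWord n a + Matrix.vecMul (fun i => m i.succ) (bitMatrix n l) := by
      ext j
      simp only [Matrix.vecMul, dotProduct, List.length_cons, Fin.sum_univ_succ, Pi.add_apply]
      rfl
    have hbit : ∀ b : ZMod 2, b = 0 ∨ b = 1 := by decide
    rw [hsplit]
    by_cases ht : (fun i : Fin l.length => m i.succ) = 0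
    · have h0 : m 0 = 1 := by
        refine (hbit _).resolve_left fun h0 => hm ?_
        ext i
        refine Fin.cases ?_ (fun i => ?_) i
        · rw [h0]; rfl
        · rw [show m i.succ = 0 from congrFun ht i]; rfl
      exact ⟨a, by simp [xorSums], by rw [ht, h0, one_smul, Matrix.zero_vecMul, add_zero]⟩
    · obtain ⟨c, hc, hcm⟩ := ih _ ht
      rcases hbit (m 0) with h0 | h0
      · exact ⟨c, by simp [xorSums, hc], by rw [h0, zero_smul, zero_add, hcm]⟩
      · refine ⟨a ^^^ c, ?_, by rw [h0, one_smul, hcm, toWord_xor]⟩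
        exact List.mem_append_right _ (List.mem_cons_of_mem _ (List.mem_map_of_mem hc))

/-- Every sum of a nonempty sublist of `l` has at least `d` digits `1` among the first `n`. -/
def minWeightCheck (n d : ℕ) (l : List ℕ) : Bool :=
  (xorSums l).all fun c => d.ble (digitCount n c)

theorem le_hammingNorm_of_minWeightCheck {n d : ℕ} {l : List ℕ} (h : minWeightCheck n d l = true)
    (m : Fin l.length → ZMod 2) (hm : m ≠ 0) :
    d ≤ hammingNorm (Matrix.vecMul m (bitMatrix n l)) := by
  obtain ⟨c, hc, hmc⟩ := vecMul_bitMatrix_mem n l m hm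
  rw [hmc, hammingNorm_toWord]
  exact Nat.le_of_ble_eq_true (List.all_eq_true.1 h c hc)

theorem hasParameters_bitMatrix {n d e : ℕ} (g h : List ℕ)
    (hgh : bitMatrix n g * (bitMatrix n h).transpose = 0) (hn : g.length + h.length = n)
    (hd : 1 ≤ d) (he : 1 ≤ e) (hg : minWeightCheck n d g = true)
    (hgd : ∃ i, hammingNorm (bitMatrix n g i) = d) (hh : minWeightCheck n e h = true)
    (hhe : ∃ i, hammingNorm (bitMatrix n h i) = e) :
    HasParameters (rowCode (bitMatrix n g)) n g.length d e :=
  hasParameters_rowCode_of_parityCheck hgh (Fintype.card_fin n) (Fintype.card_fin _)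
    (by rw [Fintype.card_fin, hn]) hd he (le_hammingNorm_of_minWeightCheck hg) hgd
    (le_hammingNorm_of_minWeightCheck hh) hhe

/-- The leftmost entry of a row is its least significant bit. -/
theorem G53_eq : G53 = bitMatrix 11 [1921, 1634, 1364, 696] := by decide +kernel

theorem G54_eq : G54 = bitMatrix 13 [7681, 4546, 3492, 2920, 5872] := by decide +kernel

theorem G55_eq :
    G55 = bitMatrix 16 [61441, 52226, 43524, 22024, 26896, 54560, 56128, 46976] := by
  decide +kernel

theorem G63_eq : G63 = bitMatrix 12 [3969, 3682, 3412, 2744] := by decide +kernel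

theorem G64_eq :
    G64 = bitMatrix 14 [14337, 13314, 11268, 7176, 12816, 10784, 6720, 9856, 5888] := by
  decide +kernel

theorem G65_eq :
    G65 = bitMatrix 17 [126977, 117762, 109060, 87560, 92432, 54560, 121664, 112512] := by
  decide +kernel

theorem G66_eq : G66 = bitMatrix 18
    [253953, 235522, 218116, 175112, 184848, 109088, 243264, 224896, 122624] := by
  decide +kernel

/-- The generator has the form `[I | A]`; the list encodes the rows of the check matrix `[Aᵀ | I]`.
The lists for the other matrices arise in the same way. -/
theorem hasParameters_G53 : HasParameters (rowCode G53) 11 4 5 3 := by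
  rw [G53_eq]
  exact hasParameters_bitMatrix _ [28, 42, 70, 137, 261, 523, 1031] (by decide +kernel) rfl
    (by decide) (by decide) (by decide +kernel) (by decide +kernel) (by decide +kernel)
    (by decide +kernel)

theorem hasParameters_G54 : HasParameters (rowCode G54) 13 5 5 4 := by
  rw [G54_eq]
  exact hasParameters_bitMatrix _ [60, 90, 150, 270, 537, 1045, 2061, 4115] (by decide +kernel) rfl
    (by decide) (by decide) (by decide +kernel) (by decide +kernel) (by decide +kernel)
    (by decide +kernel)

theorem hasParameters_G55 : HasParameters (rowCode G55) 16 8 5 5 := by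
  rw [G55_eq]
  exact hasParameters_bitMatrix _ [496, 716, 1194, 2134, 4329, 8341, 16507, 32999]
    (by decide +kernel) rfl (by decide) (by decide) (by decide +kernel) (by decide +kernel)
    (by decide +kernel) (by decide +kernel)

theorem hasParameters_G63 : HasParameters (rowCode G63) 12 4 6 3 := by
  rw [G63_eq]
  exact hasParameters_bitMatrix _ [28, 42, 70, 137, 261, 523, 1031, 2063] (by decide +kernel) rfl
    (by decide) (by decide) (by decide +kernel) (by decide +kernel) (by decide +kernel)
    (by decide +kernel)

theorem hasParameters_G64 : HasParameters (rowCode G64) 14 9 4 6 := by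
  rw [G64_eq]
  exact hasParameters_bitMatrix _ [1008, 1422, 2157, 4443, 8375] (by decide +kernel) rfl
    (by decide) (by decide) (by decide +kernel) (by decide +kernel) (by decide +kernel)
    (by decide +kernel)

theorem hasParameters_G65 : HasParameters (rowCode G65) 17 8 6 5 := by
  rw [G65_eq]
  exact hasParameters_bitMatrix _ [496, 716, 1194, 2134, 4329, 8341, 16507, 32999, 65759]
    (by decide +kernel) rfl (by decide) (by decide) (by decide +kernel) (by decide +kernel)
    (by decide +kernel) (by decide +kernel)

theorem hasParameters_G66 : HasParameters (rowCode G66) 18 9 6 6 := by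
  rw [G66_eq]
  exact hasParameters_bitMatrix _ [1008, 1484, 2474, 4438, 8425, 16789, 33147, 66023, 131295]
    (by decide +kernel) rfl (by decide) (by decide) (by decide +kernel) (by decide +kernel)
    (by decide +kernel) (by decide +kernel)

/-! ### Simplex, Hamming and Reed-Muller codes -/

/-- A kernel word of weight 1 exhibits a zero column, and one of weight 2 a pair of equal columns.
-/
theorem weightGE_three_of_columns {α : Type*} {G : Matrix α ι (ZMod 2)} (h0 : ∀ i, G.col i ≠ 0)
    (hinj : Function.Injective G.col) : WeightGE (LinearMap.ker G.mulVecLin) 3 := by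
  classical
  intro u hu hu0
  obtain ⟨s, rfl⟩ := (supportEquiv ι).surjective u
  rw [hammingNorm_supportEquiv]
  have hsum : ∑ i ∈ s, G.col i = 0 := by
    ext j
    have h := congrFun (LinearMap.mem_ker.1 hu) j
    rw [Matrix.mulVecLin_apply, Matrix.mulVec, dotProduct_comm, supportEquiv_dotProduct] at h
    simpa using h
  by_contra hlt
  have hs : s.card = 0 ∨ s.card = 1 ∨ s.card = 2 := by omega
  rcases hs with hs | hs | hs
  · rw [Finset.card_eq_zero.1 hs] at hu0
    exact hu0 (by ext i; simp [supportEquiv_apply])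
  · obtain ⟨a, rfl⟩ := Finset.card_eq_one.1 hs
    rw [Finset.sum_singleton] at hsum
    exact h0 a hsum
  · obtain ⟨a, b, hab, rfl⟩ := Finset.card_eq_two.1 hs
    rw [Finset.sum_pair hab] at hsum
    have : ∀ x y : ZMod 2, x + y = 0 → x = y := by decide
    exact hab (hinj (funext fun j => this _ _ (congrFun hsum j)))

theorem natCast_hammingNorm (u : ι → ZMod 2) : (hammingNorm u : ZMod 2) = ∑ i, u i := by
  rw [hammingNorm, Finset.card_filter, Nat.cast_sum]
  refine Finset.sum_congr rfl fun i _ => ?_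
  have : ∀ a : ZMod 2, ((if a ≠ 0 then 1 else 0 : ℕ) : ZMod 2) = a := by decide
  exact this (u i)

/-- The word with value `1` exactly on `s`. -/
def indicatorWord {α : Type*} [DecidableEq α] (s : Finset α) : α → ZMod 2 :=
  fun v => if v ∈ s then 1 else 0

/-- A row of ones on top of the matrix `G`. -/
def onesRow {α : Type*} {k : ℕ} (G : Matrix (Fin k) α (ZMod 2)) :
    Matrix (Fin (k + 1)) α (ZMod 2) :=
  Matrix.of (Fin.cons 1 G)

theorem onesRow_mulVec {k : ℕ} (G : Matrix (Fin k) ι (ZMod 2)) (u : ι → ZMod 2) :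
    Matrix.mulVec (onesRow G) u = Fin.cons (∑ i, u i) (Matrix.mulVec G u) := by
  ext j
  refine Fin.cases ?_ (fun j => ?_) j
  · exact Finset.sum_congr rfl fun i _ => one_mul (u i)
  · rfl

/-- The row of ones makes every column nonzero and every kernel word even, so weight at least 3
improves to at least 4. -/
theorem weightGE_four_of_onesRow {k : ℕ} {G : Matrix (Fin k) ι (ZMod 2)}
    (hinj : Function.Injective G.col) : WeightGE (LinearMap.ker (onesRow G).mulVecLin) 4 := by
  intro u hu hu0
  have h3 := weightGE_three_of_columns (G := onesRow G)
    (fun i h => one_ne_zero (congrFun h 0 : (1 : ZMod 2) = 0))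
    (fun i j h => hinj (funext fun l => congrFun h l.succ)) u hu hu0
  have h : (hammingNorm u : ZMod 2) = 0 := by
    rw [natCast_hammingNorm]
    have h1 : Matrix.mulVec (onesRow G) u = 0 := hu
    rw [onesRow_mulVec] at h1
    exact congrFun h1 0
  rw [ZMod.natCast_eq_zero_iff] at h
  omega

theorem HasParameters.weightGE {C : Submodule (ZMod 2) (ι → ZMod 2)} {n m d e : ℕ}
    (h : HasParameters C n m d e) (hd : 1 ≤ d) : WeightGE C d :=
  ((le_minDist_iff hd).1 h.minDist_eq.ge).2

theorem HasParameters.puncture [DecidableEq ι] {C : Submodule (ZMod 2) (ι → ZMod 2)}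
    {n m d e : ℕ} (h : HasParameters C (n + 1) m (d + 1) e) (hd : 1 ≤ d) (he : 1 ≤ e) (p : ι)
    (hx : ∃ x ∈ C, x p ≠ 0 ∧ hammingNorm x = d + 1)
    (hu : ∃ u ∈ BinaryCode.dual C, u p = 0 ∧ hammingNorm u = e) :
    HasParameters (puncture C p) n m d e where
  length_eq := by
    rw [Fintype.card_subtype_compl, Fintype.card_subtype_eq, h.length_eq, Nat.add_sub_cancel]
  finrank_eq := (finrank_puncture ((h.weightGE (by omega)).mono (by omega)) p).trans h.finrank_eq
  minDist_eq := by
    obtain ⟨x, hx, hxp, hxd⟩ := hx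
    refine minDist_eq_of_weightGE hd ((h.weightGE (by omega)).puncture p) ⟨_, ⟨x, hx, rfl⟩, ?_⟩
    have := hammingNorm_deleteCoord_of_ne_zero hxp
    omega
  dualDist_eq := by
    obtain ⟨u, hu, hup, hue⟩ := hu
    rw [dual_puncture]
    refine minDist_eq_of_weightGE he (((le_minDist_iff he).1 h.dualDist_eq.ge).2.shorten p)
      ⟨_, ⟨u, ⟨hu, hup⟩, rfl⟩, ?_⟩
    rw [hammingNorm_deleteCoord_of_eq_zero hup, hue]

theorem dual_simplexCode (r : ℕ) : dual (simplexCode r) = hammingCode r := dual_rowCode _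

theorem weightGE_hammingCode (r : ℕ) : WeightGE (hammingCode r) 3 :=
  weightGE_three_of_columns (fun v => v.2) fun _ _ h => Subtype.ext h

theorem hasParameters_simplexCode_three : HasParameters (simplexCode 3) 7 3 4 3 :=
  hasParameters_rowCode (by decide +kernel) rfl (by decide) (by decide) (by decide +kernel)
    (by decide +kernel) (weightGE_hammingCode 3)
    -- The three points of a projective line: columns `a`, `b`, `a + b` sum to 0.
    ⟨fun v => if v.1 = ![1, 0, 0] ∨ v.1 = ![0, 1, 0] ∨ v.1 = ![1, 1, 0] then 1 else 0,
      by decide +kernel⟩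

theorem hasParameters_simplexCode_four : HasParameters (simplexCode 4) 15 4 8 3 :=
  hasParameters_rowCode (by decide +kernel) rfl (by decide) (by decide) (by decide +kernel)
    (by decide +kernel) (weightGE_hammingCode 4)
    ⟨fun v => if v.1 = ![1, 0, 0, 0] ∨ v.1 = ![0, 1, 0, 0] ∨ v.1 = ![1, 1, 0, 0] then 1 else 0,
      by decide +kernel⟩

theorem hasParameters_puncture_simplexCode_three (p) :
    HasParameters (puncture (simplexCode 3) p) 6 3 3 3 := by
  refine hasParameters_simplexCode_three.puncture (by decide) (by decide) p ?_ ?_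
  · obtain ⟨i, h⟩ : ∃ i, nonzeroColumns 3 i p ≠ 0 ∧ hammingNorm (nonzeroColumns 3 i) = 4 := by
      revert p
      decide +kernel
    exact ⟨_, Submodule.subset_span ⟨i, rfl⟩, h⟩
  -- A line avoiding `p` supports a Hamming codeword of weight 3 that survives the shortening of the
  -- dual.
  · obtain ⟨a, b, hp, h0, h3⟩ : ∃ a b : Fin 3 → ZMod 2, p.1 ∉ ({a, b, a + b} : Finset _) ∧
        Matrix.mulVec (nonzeroColumns 3)
          (fun v => indicatorWord {a, b, a + b} v.1) = 0 ∧
        hammingNorm (fun v : {v : Fin 3 → ZMod 2 // v ≠ 0} =>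
          indicatorWord {a, b, a + b} v.1) = 3 := by
      revert p
      decide +kernel
    rw [dual_simplexCode]
    exact ⟨fun v => indicatorWord {a, b, a + b} v.1, LinearMap.mem_ker.2 h0, if_neg hp, h3⟩

theorem hasParameters_puncture_simplexCode_four (p) :
    HasParameters (puncture (simplexCode 4) p) 14 4 7 3 := by
  refine hasParameters_simplexCode_four.puncture (by decide) (by decide) p ?_ ?_
  · obtain ⟨i, h⟩ : ∃ i, nonzeroColumns 4 i p ≠ 0 ∧ hammingNorm (nonzeroColumns 4 i) = 8 := by
      revert p
      decide +kernel
    exact ⟨_, Submodule.subset_span ⟨i, rfl⟩, h⟩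
  · obtain ⟨a, b, hp, h0, h3⟩ : ∃ a b : Fin 4 → ZMod 2, p.1 ∉ ({a, b, a + b} : Finset _) ∧
        Matrix.mulVec (nonzeroColumns 4)
          (fun v => indicatorWord {a, b, a + b} v.1) = 0 ∧
        hammingNorm (fun v : {v : Fin 4 → ZMod 2 // v ≠ 0} =>
          indicatorWord {a, b, a + b} v.1) = 3 := by
      revert p
      decide +kernel
    rw [dual_simplexCode]
    exact ⟨fun v => indicatorWord {a, b, a + b} v.1, LinearMap.mem_ker.2 h0, if_neg hp, h3⟩

theorem hasParameters_shorten_hammingCode_three (p) :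
    HasParameters (shorten (hammingCode 3) p) 6 3 3 3 := by
  rw [← dual_simplexCode, ← dual_puncture]
  exact (hasParameters_puncture_simplexCode_three p).dual rfl

theorem hasParameters_hammingCode_three : HasParameters (hammingCode 3) 7 4 3 4 := by
  rw [← dual_simplexCode]
  exact hasParameters_simplexCode_three.dual rfl

/-- The overall parity bit is a check row of ones, and the new coordinate has a zero column in the
old checks. -/
theorem extend_ker_mulVecLin {k : ℕ} (G : Matrix (Fin k) ι (ZMod 2)) :
    extend (LinearMap.ker G.mulVecLin) =
      LinearMap.ker (onesRow (Matrix.of fun i (j : Option ι) => j.elim 0 (G i))).mulVecLin := by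
  ext u
  rw [LinearMap.mem_ker, Matrix.mulVecLin_apply, onesRow_mulVec]
  have h1 : Matrix.mulVec (Matrix.of fun i (j : Option ι) => j.elim 0 (G i)) u =
      Matrix.mulVec G fun i => u (some i) := by
    ext j
    simp [Matrix.mulVec, dotProduct, Fintype.sum_option]
  have h2 : ∀ a b : ZMod 2, a + b = 0 ↔ a = b := by decide
  rw [h1, Fintype.sum_option, show (0 : Fin (k + 1) → ZMod 2) = Fin.cons 0 0 from
    (Fin.cons_self_tail 0).symm, Fin.cons_inj, h2, and_comm]
  rfl

theorem hasParameters_extend_hammingCode_three :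
    HasParameters (extend (hammingCode 3)) 8 4 4 4 := by
  rw [hammingCode, extend_ker_mulVecLin, ← dual_rowCode]
  refine HasParameters.dual (m := 4) ?_ rfl
  refine hasParameters_rowCode (by decide +kernel) rfl (by decide) (by decide) (by decide +kernel)
    (by decide +kernel) (weightGE_four_of_onesRow ?_)
    -- The coordinate `none` plays the role of the zero vector, so this is the affine plane `{0, a,
    -- b, a + b}`, whose four columns sum to 0.
    ⟨fun v => if v = none ∨ v.elim 0 Subtype.val ∈
      ({![1, 0, 0], ![0, 1, 0], ![1, 1, 0]} : Finset (Fin 3 → ZMod 2)) then 1 else 0,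
      by decide +kernel⟩
  decide +kernel

theorem reedMullerOne_eq (m : ℕ) :
    reedMullerOne m = rowCode (onesRow (Matrix.of fun i (x : Fin m → ZMod 2) => x i)) := by
  rw [reedMullerOne, rowCode]
  congr 1
  exact (Fin.range_cons _ _).symm

theorem hasParameters_reedMullerOne_four : HasParameters (reedMullerOne 4) 16 5 8 4 := by
  rw [reedMullerOne_eq]
  exact hasParameters_rowCode (by decide +kernel) rfl (by decide) (by decide) (by decide +kernel)
    (by decide +kernel) (weightGE_four_of_onesRow fun _ _ h => h)
    ⟨fun v => if v ∈ ({0, ![1, 0, 0, 0], ![0, 1, 0, 0], ![1, 1, 0, 0]} :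
      Finset (Fin 4 → ZMod 2)) then 1 else 0, by decide +kernel⟩

theorem hasParameters_puncture_reedMullerOne_four (p) :
    HasParameters (puncture (reedMullerOne 4) p) 15 5 7 4 := by
  refine hasParameters_reedMullerOne_four.puncture (by decide) (by decide) p ?_ ?_
  · obtain ⟨m, h⟩ : ∃ m, Matrix.vecMul m
        (onesRow (Matrix.of fun i (x : Fin 4 → ZMod 2) => x i)) p ≠ 0 ∧ hammingNorm
        (Matrix.vecMul m (onesRow (Matrix.of fun i (x : Fin 4 → ZMod 2) => x i))) = 8 := by
      revert p
      decide +kernel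
    rw [reedMullerOne_eq]
    exact ⟨_, mem_rowCode.2 ⟨m, rfl⟩, h⟩
  -- A translate of a plane that misses `p` supports a dual word of weight 4.
  · obtain ⟨a, hp, h0, h4⟩ : ∃ a : Fin 4 → ZMod 2,
        p ∉ ({a, a + ![1, 0, 0, 0], a + ![0, 1, 0, 0], a + ![1, 1, 0, 0]} : Finset _) ∧
        Matrix.mulVec (onesRow (Matrix.of fun i (x : Fin 4 → ZMod 2) => x i))
          (indicatorWord {a, a + ![1, 0, 0, 0], a + ![0, 1, 0, 0], a + ![1, 1, 0, 0]}) = 0 ∧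
        hammingNorm (indicatorWord
          {a, a + ![1, 0, 0, 0], a + ![0, 1, 0, 0], a + ![1, 1, 0, 0]}) = 4 := by
      revert p
      decide +kernel
    rw [reedMullerOne_eq, dual_rowCode]
    exact ⟨_, LinearMap.mem_ker.2 h0, if_neg hp, h4⟩

end BinaryCode

theorem mainTheorem6 :
    (N 3 3 = 6 ∧ ∀ p, HasParameters (shorten (hammingCode 3) p) 6 3 3 3) ∧
    (N 4 3 = 7 ∧ HasParameters (hammingCode 3) 7 4 3 4 ∧
      HasParameters (dual (hammingCode 3)) 7 3 4 3) ∧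
    (N 4 4 = 8 ∧ HasParameters (extend (hammingCode 3)) 8 4 4 4) ∧
    (N 5 3 = 11 ∧ HasParameters (rowCode G53) 11 4 5 3) ∧
    (N 5 4 = 13 ∧ HasParameters (rowCode G54) 13 5 5 4) ∧
    (N 5 5 = 16 ∧ HasParameters (rowCode G55) 16 8 5 5) ∧
    (N 6 3 = 12 ∧ HasParameters (rowCode G63) 12 4 6 3) ∧
    (N 6 4 = 14 ∧ HasParameters (dual (rowCode G64)) 14 5 6 4) ∧
    (N 6 5 = 17 ∧ HasParameters (rowCode G65) 17 8 6 5) ∧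
    (N 6 6 = 18 ∧ HasParameters (rowCode G66) 18 9 6 6) ∧
    (N 7 3 = 14 ∧ ∀ p, HasParameters (puncture (simplexCode 4) p) 14 4 7 3) ∧
    (N 7 4 = 15 ∧ ∀ p, HasParameters (puncture (reedMullerOne 4) p) 15 5 7 4) ∧
    (N 8 3 = 15 ∧ HasParameters (simplexCode 4) 15 4 8 3) ∧
    (N 8 4 = 16 ∧ HasParameters (reedMullerOne 4) 16 5 8 4) := by
  have hdual : HasParameters (dual (hammingCode 3)) 7 3 4 3 :=
    hasParameters_hammingCode_three.dual rfl
  have h64 : HasParameters (dual (rowCode G64)) 14 5 6 4 := hasParameters_G64.dual rfl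
  have n43 : ∀ n < 7, NoCode 4 3 n := fun n hn =>
    noCode_succ_of_forall_lt (fun _ => noCode_three_three) (by decide) (by decide) hn
  -- Puncturing raises only the first parameter, so `(4,4)` is reached from `(3,4)` and, below,
  -- `(6,6)` from `(5,6)`.
  have n34 : ∀ n < 7, NoCode 3 4 n := fun n hn => (n43 n hn).symm
  have n65 : ∀ n < 17, NoCode 6 5 n := fun n hn =>
    noCode_succ_of_forall_lt (fun _ => noCode_five_five) (by decide) (by decide) hn
  have n56 : ∀ n < 17, NoCode 5 6 n := fun n hn => (n65 n hn).symm
  refine ⟨⟨N_eq (hasParameters_shorten_hammingCode_three ⟨Pi.single 0 1, by decide⟩)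
      fun _ => noCode_three_three, hasParameters_shorten_hammingCode_three⟩,
    ⟨N_eq hdual n43, hasParameters_hammingCode_three, hdual⟩,
    ⟨N_eq hasParameters_extend_hammingCode_three fun n hn =>
      noCode_succ_of_forall_lt n34 (by decide) (by decide) hn,
      hasParameters_extend_hammingCode_three⟩,
    ⟨N_eq hasParameters_G53 fun _ => noCode_five_three, hasParameters_G53⟩,
    ⟨N_eq hasParameters_G54 fun _ => noCode_five_four, hasParameters_G54⟩,
    ⟨N_eq hasParameters_G55 fun _ => noCode_five_five, hasParameters_G55⟩,
    ⟨N_eq hasParameters_G63 fun n hn => noCode_succ_of_forall_lt (fun _ => noCode_five_three)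
      (by decide) (by decide) hn, hasParameters_G63⟩,
    ⟨N_eq h64 fun n hn => noCode_succ_of_forall_lt (fun _ => noCode_five_four)
      (by decide) (by decide) hn, h64⟩,
    ⟨N_eq hasParameters_G65 n65, hasParameters_G65⟩,
    ⟨N_eq hasParameters_G66 fun n hn => noCode_succ_of_forall_lt n56
      (by decide) (by decide) hn, hasParameters_G66⟩,
    ⟨N_eq (hasParameters_puncture_simplexCode_four ⟨Pi.single 0 1, by decide⟩)
      fun _ => noCode_seven_three, hasParameters_puncture_simplexCode_four⟩,
    ⟨N_eq (hasParameters_puncture_reedMullerOne_four 0)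
      fun _ => noCode_seven_four, hasParameters_puncture_reedMullerOne_four⟩,
    ⟨N_eq hasParameters_simplexCode_four fun n hn =>
      noCode_succ_of_forall_lt (fun _ => noCode_seven_three) (by decide) (by decide) hn,
      hasParameters_simplexCode_four⟩,
    ⟨N_eq hasParameters_reedMullerOne_four fun n hn =>
      noCode_succ_of_forall_lt (fun _ => noCode_seven_four) (by decide) (by decide) hn,
      hasParameters_reedMullerOne_four⟩⟩
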